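/- Let $1<p\le q<\infty$, let $m,n_1,\dots,n_m$ be positive integers, and for $1\le i\le m$ let $\alpha_i,\beta_i,\gamma_i$ be real numbers with $0\le\beta_i<n_i$, $\gamma_i<n_i(p-1)$ and $$\beta_i+\frac{\alpha_i+n_i}{q}=\frac{\gamma_i+n_i}{p}.$$ Write $X=\mathbb R^{n_1}\times\cdots\times\mathbb R^{n_m}$. For $\delta\in\mathbb R^m$ put $|x|^{\delta}=\prod_{i=1}^m|x_i|^{\delta_i}$, and let $L^r(X,|x|^{\delta})$ be the $L^r$ space of the measure $|x|^{\delta}dx$ on $X$. Define $$\mathscr H_{\beta_1,\dots,\beta_m}(f)(x)=\prod_{i=1}^m\frac{1}{|B(0,|x_i|)|^{1-\beta_i/n_i}}\int_{|y_1|<|x_1|}\cdots\int_{|y_m|<|x_m|}f(y_1,\dots,y_m)\,dy_1\cdots dy_m$$ for $x\in X$ with $\prod_i|x_i|\ne0$, where $|B(0,r)|$ is the volume of the ball of radius $r$. Then for every real- or complex-valued $f\in L^p(X,|x|^{\gamma})$ the integral exists for every such $x$, the function $\mathscr H_{\beta_1,\dots,\beta_m}(f)$ belongs to $L^q(X,|x|^{\alpha})$,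 and $$\|\mathscr H_{\beta_1,\dots,\beta_m}(f)\|_{L^q(X,|x|^{\alpha})}\le C^*\,\|f\|_{L^p(X,|x|^{\gamma})}.$$ Moreover, the operator norm is exactly $$\|\mathscr H_{\beta_1,\dots,\beta_m}\|_{L^p(X,|x|^{\gamma})\to L^q(X,|x|^{\alpha})}=\sup_{\|f\|_{L^p(X,|x|^{\gamma})}\ne0}\frac{\|\mathscr H_{\beta_1,\dots,\beta_m}(f)\|_{L^q(X,|x|^{\alpha})}}{\|f\|_{L^p(X,|x|^{\gamma})}}=C^*,$$ and the supremum is the same if it is taken over non-negative $f$ only. Here $$C^*=\prod_{i=1}^m|S^{n_i-1}|^{\frac1q-\frac1p+\frac{\beta_i}{n_i}}\,n_i^{\frac1p-\frac1q-\frac{\beta_i}{n_i}}\left(\frac{n_i(p-1)}{n_i(p-1)-\gamma_i}\right)^{\frac1{p'}+\frac1q}A_{p,q},$$ where $|S^{n-1}|=2\pi^{n/2}/\Gamma(n/2)$ is the surface area of the unit sphere, $p'=p/(p-1)$, $q'=q/(q-1)$, and, with the beta function $B(z,w)=\int_0^1t^{z-1}(1-t)^{w-1}\,dt$, $$A_{p,q}=\left(\frac{p'}{q}\right)^{1/q}\left(\frac{p}{q-p}\,B\left(\frac{p}{q-p},\frac{pq}{q'(q-p)}\right)\right)^{\frac1q-\frac1p}\quad(p<q),\qquad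 A_{p,p}=\lim_{q\downarrow p}A_{p,q}=\frac{p}{p-1}.$$ -/

import Mathlib

open MeasureTheory
open scoped ENNReal

noncomputable section

/-- The product space `ℝ^{n₁} × ⋯ × ℝ^{n_m}`, with the product of the Lebesgue measures as `volume`. -/
abbrev ProdSpace {m : ℕ} (n : Fin m → ℕ) : Type :=
  (i : Fin m) → EuclideanSpace ℝ (Fin (n i))

/-- The product of the open balls `B(0,|x_i|)`. -/
def ballBox {m : ℕ} {n : Fin m → ℕ} (x : ProdSpace n) : Set (ProdSpace n) :=
  {y | ∀ i, ‖y i‖ < ‖x i‖}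

/-- The fractional Hardy type operator `𝓗_{β₁,…,β_m}`. -/
def hardyOp {𝕜 : Type*} [RCLike 𝕜] {m : ℕ} {n : Fin m → ℕ} (β : Fin m → ℝ)
    (f : ProdSpace n → 𝕜) (x : ProdSpace n) : 𝕜 :=
  (∏ i, 1 / (volume (Metric.ball (0 : EuclideanSpace ℝ (Fin (n i))) ‖x i‖)).toReal
      ^ (1 - β i / (n i : ℝ))) • ∫ y in ballBox x, f y

/-- The measure `|x|^γ dx`, where `|x|^γ = ∏ i, |x_i|^{γ_i}`. -/
def powerMeasure {m : ℕ} (n : Fin m → ℕ) (γ : Fin m → ℝ) : Measure (ProdSpace n) :=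
  volume.withDensity fun x => ENNReal.ofReal (∏ i, ‖x i‖ ^ γ i)

/-- The norm of `f` in `L^p(|x|^γ)`, with values in `[0,∞]`. -/
def weightedNorm {𝕜 : Type*} [RCLike 𝕜] {m : ℕ} {n : Fin m → ℕ} (p : ℝ) (γ : Fin m → ℝ)
    (f : ProdSpace n → 𝕜) : ℝ≥0∞ :=
  eLpNorm f (ENNReal.ofReal p) (powerMeasure n γ)

/-- Membership in `L^p(|x|^γ)`. -/
def MemWeightedLp {𝕜 : Type*} [RCLike 𝕜] {m : ℕ} {n : Fin m → ℕ} (p : ℝ) (γ : Fin m → ℝ)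
    (f : ProdSpace n → 𝕜) : Prop :=
  MemLp f (ENNReal.ofReal p) (powerMeasure n γ)

/-- The operator norm of `𝓗_{β₁,…,β_m}` from `L^p(|x|^γ)` to `L^q(|x|^α)`, for functions with
values in `𝕜`. -/
def hardyNorm (𝕜 : Type*) [RCLike 𝕜] {m : ℕ} (n : Fin m → ℕ) (β : Fin m → ℝ)
    (p : ℝ) (γ : Fin m → ℝ) (q : ℝ) (α : Fin m → ℝ) : ℝ≥0∞ :=
  ⨆ f ∈ {f : ProdSpace n → 𝕜 | MemWeightedLp p γ f ∧ weightedNorm p γ f ≠ 0},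
    weightedNorm q α (hardyOp β f) / weightedNorm p γ f

/-- The same supremum over the non-negative functions only. -/
def hardyNormNonneg {m : ℕ} (n : Fin m → ℕ) (β : Fin m → ℝ)
    (p : ℝ) (γ : Fin m → ℝ) (q : ℝ) (α : Fin m → ℝ) : ℝ≥0∞ :=
  ⨆ f ∈ {f : ProdSpace n → ℝ |
      (∀ x, 0 ≤ f x) ∧ MemWeightedLp p γ f ∧ weightedNorm p γ f ≠ 0},
    weightedNorm q α (hardyOp β f) / weightedNorm p γ f

/-- The surface area `|S^{n-1}|` of the unit sphere of `ℝ^n`. -/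
def sphereArea (n : ℕ) : ℝ :=
  ((volume : Measure (EuclideanSpace ℝ (Fin n))).toSphere Set.univ).toReal

/-- The beta function (for positive real arguments). -/
def betaFn (z w : ℝ) : ℝ :=
  ∫ t in (0 : ℝ)..1, t ^ (z - 1) * (1 - t) ^ (w - 1)

/-- The Bliss factor. For `p = q` the formula makes no sense as written, and it is read as its
limit for `q → p`, which is `p / (p - 1)`. -/
def blissFactor (p q : ℝ) : ℝ :=
  if p = q then p / (p - 1)
  else (p.conjExponent / q) ^ (1 / q) *
    (p / (q - p) * betaFn (p / (q - p)) (p * q / (q.conjExponent * (q - p)))) ^ (1 / q - 1 / p)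

/-- The constant `C*`. -/
def sharpConst {m : ℕ} (n : Fin m → ℕ) (β γ : Fin m → ℝ) (p q : ℝ) : ℝ :=
  ∏ i, sphereArea (n i) ^ (1 / q - 1 / p + β i / (n i : ℝ)) *
    (n i : ℝ) ^ (1 / p - 1 / q - β i / (n i : ℝ)) *
    ((n i : ℝ) * (p - 1) / ((n i : ℝ) * (p - 1) - γ i)) ^ (1 / p.conjExponent + 1 / q) *
    blissFactor p q

end

/-!
In polar coordinates, with the change of variable `u = ‖x‖ ^ c` in each factor and Hölder's
inequality on the spheres, the operator in one variable reduces to the one-dimensional inequality of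
Bliss, `∫ F ^ q x ^ (-1 - q / p') ≤ A_{p,q} ^ q (∫ (F') ^ p) ^ (q / p)`, and for radial functions
nothing is lost. The variational problem behind Bliss' inequality is autonomous in `log x` for the
rescaled primitive `u = F x ^ (-1 / p')`, so it is solved by a calibration: integrating the tangent
line inequality for `w ↦ w ^ p` along the slope of the extremal through the current value of `u`,
on its rising branch up to the maximum of `u` and on its falling branch afterwards, bounds
`∫ (F') ^ p` from below, with equality at the extremal.

Since `p ≤ q`, Minkowski's integral inequality multiplies the bounds for the single variables, and
products of near extremals show that the product of the constants cannot be improved.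
-/

noncomputable section

open Set Filter Topology

lemma absolutelyContinuousOnInterval_comp_of_contDiff {φ u : ℝ → ℝ} {a b : ℝ}
    (hφ : ContDiff ℝ 1 φ) (hu : AbsolutelyContinuousOnInterval u a b) :
    AbsolutelyContinuousOnInterval (φ ∘ u) a b := by
  obtain ⟨R, hR⟩ := hu.exists_bound
  obtain ⟨K, hK⟩ := hφ.contDiffOn.exists_lipschitzOnWith one_ne_zero
    (convex_closedBall (0 : ℝ) R) (isCompact_closedBall _ _)
  have hball : ∀ x ∈ uIcc a b, u x ∈ Metric.closedBall (0 : ℝ) R := fun x hx =>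
    mem_closedBall_zero_iff.2 (hR x hx)
  rw [absolutelyContinuousOnInterval_iff] at hu ⊢
  intro ε hε
  obtain ⟨δ, hδ, hsum⟩ := hu (ε / (K + 1)) (by positivity)
  refine ⟨δ, hδ, fun I hI hIδ => ?_⟩
  calc ∑ i ∈ Finset.range I.1, dist (φ (u (I.2 i).1)) (φ (u (I.2 i).2))
      ≤ ∑ i ∈ Finset.range I.1, K * dist (u (I.2 i).1) (u (I.2 i).2) :=
        Finset.sum_le_sum fun i hi =>
          hK.dist_le_mul _ (hball _ (hI.1 i hi).1) _ (hball _ (hI.1 i hi).2)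
    _ = K * ∑ i ∈ Finset.range I.1, dist (u (I.2 i).1) (u (I.2 i).2) :=
        (Finset.mul_sum _ _ _).symm
    _ ≤ K * (ε / (K + 1)) := by gcongr; exact (hsum I hI hIδ).le
    _ < (K + 1) * (ε / (K + 1)) := by gcongr; linarith
    _ = ε := by field

lemma integral_comp_mul_deriv_of_absolutelyContinuousOnInterval {φ u : ℝ → ℝ} {a b : ℝ}
    (hφ : Continuous φ) (hu : AbsolutelyContinuousOnInterval u a b) :
    IntervalIntegrable (fun x => φ (u x) * deriv u x) volume a b ∧
      ∫ x in a..b, φ (u x) * deriv u x = ∫ v in u a..u b, φ v := by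
  set Φ : ℝ → ℝ := fun w => ∫ v in (0 : ℝ)..w, φ v
  have hΦ : ∀ w, HasDerivAt Φ (φ w) w := fun w => hφ.integral_hasStrictDerivAt 0 w |>.hasDerivAt
  have hΦ1 : ContDiff ℝ 1 Φ := by
    rw [contDiff_one_iff_deriv]
    exact ⟨fun w => (hΦ w).differentiableAt, by simpa only [funext fun w => (hΦ w).deriv] using hφ⟩
  have hac := absolutelyContinuousOnInterval_comp_of_contDiff hΦ1 hu
  have hderiv : ∀ᵐ x, x ∈ uIoc a b → deriv (Φ ∘ u) x = φ (u x) * deriv u x := by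
    filter_upwards [hu.ae_differentiableAt] with x hx hxab
    exact ((hΦ (u x)).comp x (hx (uIoc_subset_uIcc hxab)).hasDerivAt).deriv
  constructor
  · exact hac.intervalIntegrable_deriv.congr_ae
      ((ae_restrict_iff' measurableSet_uIoc).2 hderiv)
  · rw [← intervalIntegral.integral_congr_ae hderiv, hac.integral_deriv_eq_sub]
    exact intervalIntegral.integral_interval_sub_left (hφ.intervalIntegrable _ _)
      (hφ.intervalIntegrable _ _)

lemma rpow_sub_one_mul_self {p z : ℝ} (hp : p ≠ 0) (hz : 0 ≤ z) : z ^ (p - 1) * z = z ^ p := by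
  rw [← Real.rpow_add_one' hz (by simpa using hp), sub_add_cancel]

lemma rpow_add_mul_sub_le_rpow {p v w : ℝ} (hp : 1 < p) (hv : 0 ≤ v) (hw : 0 ≤ w) :
    v ^ p + p * v ^ (p - 1) * (w - v) ≤ w ^ p := by
  have hconj := Real.HolderConjugate.conjExponent hp
  have hp0 := hconj.pos
  have young := Real.young_inequality_of_nonneg hw (Real.rpow_nonneg hv (p - 1)) hconj
  rw [← Real.rpow_mul hv, Real.conjExponent, mul_div_cancel₀ _ hconj.sub_one_ne_zero] at young
  calc v ^ p + p * v ^ (p - 1) * (w - v) = p * (w * v ^ (p - 1)) - (p - 1) * v ^ p := by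
        rw [← rpow_sub_one_mul_self hp0.ne' hv]; ring
    _ ≤ p * (w ^ p / p + v ^ p / (p / (p - 1))) - (p - 1) * v ^ p := by gcongr
    _ = w ^ p := by field [hconj.sub_one_ne_zero]

/-- The primitive `F`, rescaled to the dilation-invariant quantity `F(x) x^{-1/p'}`; in terms of it
the variational problem behind the one-dimensional inequality becomes autonomous in `log x`. -/
def rescaledPrimitive (p : ℝ) (F : ℝ → ℝ) (x : ℝ) : ℝ :=
  F x * x ^ (-((p - 1) / p))

lemma rescaledPrimitive_nonneg {p x : ℝ} {F : ℝ → ℝ} (hx : 0 ≤ x) (hF : 0 ≤ F x) :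
    0 ≤ rescaledPrimitive p F x :=
  mul_nonneg hF (Real.rpow_nonneg hx _)

lemma hasDerivAt_rescaledPrimitive {p x y : ℝ} {F : ℝ → ℝ} (hp : p ≠ 0) (hx : 0 < x)
    (hF : HasDerivAt F y x) :
    HasDerivAt (rescaledPrimitive p F)
      ((x ^ (1 / p) * y - (p - 1) / p * rescaledPrimitive p F x) / x) x := by
  refine (hF.mul (Real.hasDerivAt_rpow_const (Or.inl hx.ne'))).congr_deriv ?_
  have hpow : x ^ (-((p - 1) / p)) = x ^ (1 / p) / x := by
    rw [← Real.rpow_sub_one hx.ne']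
    congr 1
    field
  rw [rescaledPrimitive, Real.rpow_sub_one hx.ne', hpow]
  field

lemma absolutelyContinuousOnInterval_rescaledPrimitive {p a b : ℝ} {F : ℝ → ℝ} (ha : 0 < a)
    (hb : 0 < b) (hF : AbsolutelyContinuousOnInterval F a b) :
    AbsolutelyContinuousOnInterval (rescaledPrimitive p F) a b := by
  refine hF.mul (ContDiffOn.absolutelyContinuousOnInterval fun x hx => ?_)
  have hx0 : 0 < x := (lt_min ha hb).trans_le hx.1
  exact (Real.contDiffAt_rpow_const_of_ne hx0.ne').contDiffWithinAt

lemma rescaledPrimitive_rpow_div {p q x : ℝ} {F : ℝ → ℝ} (hx : 0 < x) (hF : 0 ≤ F x) :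
    rescaledPrimitive p F x ^ q / x = F x ^ q * x ^ (-1 - q * ((p - 1) / p)) := by
  rw [rescaledPrimitive, Real.mul_rpow hF (by positivity), ← Real.rpow_mul hx.le, mul_div_assoc,
    ← Real.rpow_sub_one hx.ne']
  ring_nf

-- The tangent line of `w ↦ w ^ p` at `w = u s`, where `x u' = w - u / p'` and `w = x ^ (1 / p) y`.
lemma le_rpow_of_tangent {p s u x y : ℝ} (hp : 1 < p) (hs : 0 ≤ s) (hu : 0 ≤ u) (hx : 0 < x)
    (hy : 0 ≤ y) :
    p * (u * s) ^ (p - 1) * ((x ^ (1 / p) * y - (p - 1) / p * u) / x) +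
      (p - 1) * (s ^ (p - 1) * (1 - s) * u ^ p / x) ≤ y ^ p := by
  have hp0 : 0 < p := by linarith
  have htangent := rpow_add_mul_sub_le_rpow hp (mul_nonneg hu hs)
    (mul_nonneg (Real.rpow_nonneg hx.le (1 / p)) hy)
  have hw : (x ^ (1 / p) * y) ^ p = x * y ^ p := by
    rw [Real.mul_rpow (by positivity) hy, ← Real.rpow_mul hx.le, one_div_mul_cancel hp0.ne',
      Real.rpow_one]
  rw [hw, ← rpow_sub_one_mul_self hp0.ne' (mul_nonneg hu hs), Real.mul_rpow hu hs] at htangent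
  rw [← mul_le_mul_iff_right₀ hx, ← rpow_sub_one_mul_self hp0.ne' hu, Real.mul_rpow hu hs]
  refine le_trans (le_of_eq ?_) htangent
  field

section Calibration

variable {p q C a b : ℝ} {h F : ℝ → ℝ}

lemma intervalIntegrable_rpow_mul_rpow (hq : 0 ≤ q) (ha : 0 < a) (hb : 0 < b)
    (hF : ContinuousOn F (uIcc a b)) (r : ℝ) :
    IntervalIntegrable (fun x => F x ^ q * x ^ r) volume a b :=
  ContinuousOn.intervalIntegrable <| (hF.rpow_const fun _ _ => Or.inr hq).mul
    (continuousOn_id.rpow_const fun _ hx => Or.inl ((lt_min ha hb).trans_le hx.1).ne')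

lemma continuous_mul_mul_rpow_sub_one (hp : 1 < p) {σ : ℝ → ℝ} (hσ : Continuous σ) :
    Continuous fun v => p * (v * σ v) ^ (p - 1) :=
  continuous_const.mul ((continuous_id.mul hσ).rpow_const fun _ => Or.inr (by linarith))

lemma integral_branch_add_le (hp : 1 < p) (hq : 0 < q) (ha : 0 < a) (hab : a ≤ b)
    (hF : AbsolutelyContinuousOnInterval F a b)
    (hF' : ∀ᵐ x, x ∈ uIcc a b → HasDerivAt F (h x) x) (hF0 : ∀ x ∈ Icc a b, 0 ≤ F x)
    (hh : ∀ x ∈ Icc a b, 0 ≤ h x) (hhp : IntervalIntegrable (fun x => h x ^ p) volume a b)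
    {σ : ℝ → ℝ} (hσ : Continuous σ)
    (hσ0 : ∀ x ∈ Icc a b, 0 ≤ σ (rescaledPrimitive p F x))
    (hσC : ∀ x ∈ Icc a b,
      σ (rescaledPrimitive p F x) ^ (p - 1) * (1 - σ (rescaledPrimitive p F x)) =
        C * rescaledPrimitive p F x ^ (q - p)) :
    (∫ v in rescaledPrimitive p F a..rescaledPrimitive p F b, p * (v * σ v) ^ (p - 1)) +
      (p - 1) * C * ∫ x in a..b, F x ^ q * x ^ (-1 - q * ((p - 1) / p)) ≤
      ∫ x in a..b, h x ^ p := by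
  have hp0 : 0 < p := by linarith
  set u := rescaledPrimitive p F
  have hu := absolutelyContinuousOnInterval_rescaledPrimitive (p := p) ha (ha.trans_le hab) hF
  obtain ⟨hint, hchange⟩ := integral_comp_mul_deriv_of_absolutelyContinuousOnInterval
    (continuous_mul_mul_rpow_sub_one hp hσ) hu
  have hweight := intervalIntegrable_rpow_mul_rpow hq.le ha (ha.trans_le hab) hF.continuousOn
    (-1 - q * ((p - 1) / p))
  rw [← hchange, ← intervalIntegral.integral_const_mul,
    ← intervalIntegral.integral_add hint (hweight.const_mul _)]
  refine intervalIntegral.integral_mono_ae_restrict hab (hint.add (hweight.const_mul _)) hhp ?_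
  filter_upwards [ae_restrict_of_ae hF', ae_restrict_mem measurableSet_Icc] with x hFx hx
  have hx0 : 0 < x := ha.trans_le hx.1
  have hux : 0 ≤ u x := rescaledPrimitive_nonneg hx0.le (hF0 x hx)
  have htangent := le_rpow_of_tangent hp (hσ0 x hx) hux hx0 (hh x hx)
  have hpq : u x ^ (q - p) * u x ^ p = u x ^ q := by
    rw [← Real.rpow_add' hux (by simpa using hq.ne'), sub_add_cancel]
  rw [hσC x hx, mul_assoc C, hpq, mul_div_assoc, rescaledPrimitive_rpow_div hx0 (hF0 x hx),
    ← mul_assoc (p - 1)] at htangent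
  rwa [(hasDerivAt_rescaledPrimitive hp0.ne' hx0 (hFx (Icc_subset_uIcc hx))).deriv]

lemma integral_branches_add_le (hp : 1 < p) (hq : 0 < q) (ha : 0 < a) {c : ℝ} (hc : c ∈ Icc a b)
    (hF : AbsolutelyContinuousOnInterval F a b)
    (hF' : ∀ᵐ x, x ∈ uIcc a b → HasDerivAt F (h x) x) (hF0 : ∀ x ∈ Icc a b, 0 ≤ F x)
    (hh : ∀ x ∈ Icc a b, 0 ≤ h x) (hhp : IntervalIntegrable (fun x => h x ^ p) volume a b)
    {S : Set ℝ} (hS : ∀ x ∈ Icc a b, rescaledPrimitive p F x ∈ S)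
    {σ τ : ℝ → ℝ} (hσ : Continuous σ) (hτ : Continuous τ)
    (hσC : ∀ v ∈ S, 0 ≤ σ v ∧ σ v ^ (p - 1) * (1 - σ v) = C * v ^ (q - p))
    (hτC : ∀ v ∈ S, 0 ≤ τ v ∧ τ v ^ (p - 1) * (1 - τ v) = C * v ^ (q - p)) :
    (∫ v in rescaledPrimitive p F a..rescaledPrimitive p F c, p * (v * σ v) ^ (p - 1)) +
      (∫ v in rescaledPrimitive p F c..rescaledPrimitive p F b, p * (v * τ v) ^ (p - 1)) +
      (p - 1) * C * ∫ x in a..b, F x ^ q * x ^ (-1 - q * ((p - 1) / p)) ≤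
      ∫ x in a..b, h x ^ p := by
  have hab : a ≤ b := hc.1.trans hc.2
  have hleft : Icc a c ⊆ Icc a b := Icc_subset_Icc_right hc.2
  have hright : Icc c b ⊆ Icc a b := Icc_subset_Icc_left hc.1
  have uIcc_left : uIcc a c ⊆ uIcc a b := by rwa [uIcc_of_le hc.1, uIcc_of_le hab]
  have uIcc_right : uIcc c b ⊆ uIcc a b := by rwa [uIcc_of_le hc.2, uIcc_of_le hab]
  have rising := integral_branch_add_le (C := C) hp hq ha hc.1 (hF.mono uIcc_left)
    (hF'.mono fun x hx hxc => hx (uIcc_left hxc)) (fun x hx => hF0 x (hleft hx))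
    (fun x hx => hh x (hleft hx)) (hhp.mono_set uIcc_left) hσ
    (fun x hx => (hσC _ (hS x (hleft hx))).1) (fun x hx => (hσC _ (hS x (hleft hx))).2)
  have falling := integral_branch_add_le (C := C) hp hq (ha.trans_le hc.1) hc.2 (hF.mono uIcc_right)
    (hF'.mono fun x hx hxc => hx (uIcc_right hxc)) (fun x hx => hF0 x (hright hx))
    (fun x hx => hh x (hright hx)) (hhp.mono_set uIcc_right) hτ
    (fun x hx => (hτC _ (hS x (hright hx))).1) (fun x hx => (hτC _ (hS x (hright hx))).2)
  have hweight := intervalIntegrable_rpow_mul_rpow hq.le ha (ha.trans_le hab) hF.continuousOn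
    (-1 - q * ((p - 1) / p))
  rw [← intervalIntegral.integral_add_adjacent_intervals (hhp.mono_set uIcc_left)
    (hhp.mono_set uIcc_right), ← intervalIntegral.integral_add_adjacent_intervals
    (hweight.mono_set uIcc_left) (hweight.mono_set uIcc_right)]
  linarith

lemma integral_rpow_ge_of_calibration (hp : 1 < p) (hq : 0 < q) (ha : 0 < a) {c m : ℝ}
    (hc : c ∈ Icc a b) (hF : AbsolutelyContinuousOnInterval F a b) (hFa : F a = 0)
    (hF' : ∀ᵐ x, x ∈ uIcc a b → HasDerivAt F (h x) x) (hF0 : ∀ x ∈ Icc a b, 0 ≤ F x)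
    (hh : ∀ x ∈ Icc a b, 0 ≤ h x) (hhp : IntervalIntegrable (fun x => h x ^ p) volume a b)
    (hcm : rescaledPrimitive p F c = m) (hm : ∀ x ∈ Icc a b, rescaledPrimitive p F x ≤ m)
    {σ τ : ℝ → ℝ} (hσ : Continuous σ) (hτ : Continuous τ)
    (hσC : ∀ v ∈ Icc 0 m, 0 ≤ σ v ∧ σ v ^ (p - 1) * (1 - σ v) = C * v ^ (q - p))
    (hτC : ∀ v ∈ Icc 0 m, 0 ≤ τ v ∧ τ v ^ (p - 1) * (1 - τ v) = C * v ^ (q - p)) :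
    (∫ v in 0..m, (p * (v * σ v) ^ (p - 1) - p * (v * τ v) ^ (p - 1))) +
      (p - 1) * C * ∫ x in a..b, F x ^ q * x ^ (-1 - q * ((p - 1) / p)) ≤
      ∫ x in a..b, h x ^ p := by
  have hu : ∀ x ∈ Icc a b, rescaledPrimitive p F x ∈ Icc 0 m := fun x hx =>
    ⟨rescaledPrimitive_nonneg (ha.le.trans hx.1) (hF0 x hx), hm x hx⟩
  have hua : rescaledPrimitive p F a = 0 := by rw [rescaledPrimitive, hFa, zero_mul]
  have hub := hu b (right_mem_Icc.2 (hc.1.trans hc.2))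
  have hτub : 0 ≤ ∫ v in 0..rescaledPrimitive p F b, p * (v * τ v) ^ (p - 1) :=
    intervalIntegral.integral_nonneg hub.1 fun v hv => by
      have := (hτC v ⟨hv.1, hv.2.trans hub.2⟩).1
      have := hv.1
      positivity
  have hbranches := integral_branches_add_le hp hq ha hc hF hF' hF0 hh hhp hu hσ hτ hσC hτC
  have hσint := (continuous_mul_mul_rpow_sub_one hp hσ).intervalIntegrable (μ := volume)
  have hτint := (continuous_mul_mul_rpow_sub_one hp hτ).intervalIntegrable (μ := volume)
  rw [hua, hcm, ← intervalIntegral.integral_interval_sub_left (hτint 0 _) (hτint 0 m)] at hbranches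
  rw [intervalIntegral.integral_sub (hσint _ _) (hτint _ _)]
  linarith

end Calibration

section Inverse

variable {f : ℝ → ℝ} {a b : ℝ}

lemma exists_continuous_inverse_of_strictMonoOn (hab : a ≤ b) (hf : ContinuousOn f (Icc a b))
    (hmono : StrictMonoOn f (Icc a b)) :
    ∃ σ : ℝ → ℝ, Continuous σ ∧ (∀ s ∈ Icc a b, σ (f s) = s) ∧
      ∀ c ∈ Icc (f a) (f b), σ c ∈ Icc a b ∧ f (σ c) = c := by
  have hmaps : MapsTo f (Icc a b) (Icc (f a) (f b)) := hmono.monotoneOn.mapsTo_Icc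
  have hsurj : Function.Surjective hmaps.restrict :=
    (MapsTo.restrict_surjective_iff hmaps).2 (intermediate_value_Icc hab hf)
  have hstrict : StrictMono hmaps.restrict := fun x y hxy => hmono x.2 y.2 hxy
  set e := hstrict.orderIsoOfSurjective _ hsurj
  have hfab : f a ≤ f b := hmono.monotoneOn (left_mem_Icc.2 hab) (right_mem_Icc.2 hab) hab
  refine ⟨IccExtend hfab fun c => (e.symm c : ℝ),
    (continuous_subtype_val.comp e.symm.continuous).Icc_extend', fun s hs => ?_, fun c hc => ?_⟩
  · rw [IccExtend_of_mem _ _ (hmaps hs)]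
    exact congrArg Subtype.val (e.symm_apply_apply ⟨s, hs⟩)
  · rw [IccExtend_of_mem _ _ hc]
    exact ⟨(e.symm ⟨c, hc⟩).2, congrArg Subtype.val (e.apply_symm_apply ⟨c, hc⟩)⟩

lemma exists_continuous_inverse_of_strictAntiOn (hab : a ≤ b) (hf : ContinuousOn f (Icc a b))
    (hanti : StrictAntiOn f (Icc a b)) :
    ∃ σ : ℝ → ℝ, Continuous σ ∧ (∀ s ∈ Icc a b, σ (f s) = s) ∧
      ∀ c ∈ Icc (f b) (f a), σ c ∈ Icc a b ∧ f (σ c) = c := by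
  obtain ⟨σ, hσ, hleft, hright⟩ := exists_continuous_inverse_of_strictMonoOn hab hf.neg hanti.neg
  refine ⟨fun c => σ (-c), hσ.comp continuous_neg, hleft, fun c hc => ?_⟩
  obtain ⟨hmem, heq⟩ := hright (-c) ⟨neg_le_neg hc.2, neg_le_neg hc.1⟩
  exact ⟨hmem, neg_injective heq⟩

end Inverse

section LevelFunction

variable {p : ℝ}

lemma continuous_rpow_mul_one_sub (hp : 1 < p) : Continuous fun s : ℝ => s ^ (p - 1) * (1 - s) :=
  (Real.continuous_rpow_const (by linarith)).mul (continuous_const.sub continuous_id)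

lemma hasDerivAt_rpow_mul_one_sub (hp : 1 < p) {s : ℝ} (hs : 0 < s) :
    HasDerivAt (fun s : ℝ => s ^ (p - 1) * (1 - s)) (s ^ (p - 2) * p * ((p - 1) / p - s)) s := by
  refine ((Real.hasDerivAt_rpow_const (Or.inl hs.ne')).mul
    ((hasDerivAt_id' s).const_sub 1)).congr_deriv ?_
  have hpow : s ^ (p - 1) = s ^ (p - 2) * s := by
    rw [← Real.rpow_add_one hs.ne']
    ring_nf
  rw [hpow, show p - 1 - 1 = p - 2 by ring]
  field

lemma strictMonoOn_rpow_mul_one_sub (hp : 1 < p) :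
    StrictMonoOn (fun s : ℝ => s ^ (p - 1) * (1 - s)) (Icc 0 ((p - 1) / p)) := by
  refine strictMonoOn_of_deriv_pos (convex_Icc _ _)
    (continuous_rpow_mul_one_sub hp).continuousOn fun s hs => ?_
  rw [interior_Icc] at hs
  have := sub_pos.2 hs.2
  have := hs.1
  rw [(hasDerivAt_rpow_mul_one_sub hp hs.1).deriv]
  positivity

lemma strictAntiOn_rpow_mul_one_sub (hp : 1 < p) :
    StrictAntiOn (fun s : ℝ => s ^ (p - 1) * (1 - s)) (Icc ((p - 1) / p) 1) := by
  refine strictAntiOn_of_deriv_neg (convex_Icc _ _)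
    (continuous_rpow_mul_one_sub hp).continuousOn fun s hs => ?_
  rw [interior_Icc] at hs
  have hs0 : 0 < s := (div_nonneg (by linarith) (by linarith)).trans_lt hs.1
  rw [(hasDerivAt_rpow_mul_one_sub hp hs0).deriv]
  exact mul_neg_of_pos_of_neg (by positivity) (sub_neg.2 hs.1)

end LevelFunction

/-- The `p`-th power of Bliss' extremal function `t ↦ (1 + t ^ l) ^ (-(1 + l) / l)`, where
`q = p (1 + l)`. -/
def blissDensity (p l t : ℝ) : ℝ := (1 + t ^ l) ^ (-(p * (1 + l) / l))

/-- The rescaled primitive `x ^ (1 / p) (1 + x ^ l) ^ (-1 / l)` of Bliss' extremal function. -/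
def blissProfile (p l x : ℝ) : ℝ := x ^ (1 / p) * (1 + x ^ l) ^ (-(1 / l))

/-- The point at which `blissProfile p l` is maximal. -/
def blissPeak (p l : ℝ) : ℝ := (p - 1)⁻¹ ^ (1 / l)

section BlissExtremal

variable {p l t x : ℝ}

lemma blissDensity_pos (ht : 0 ≤ t) : 0 < blissDensity p l t := by
  unfold blissDensity; positivity

lemma continuousOn_one_add_rpow_rpow (hl : 0 < l) (r : ℝ) :
    ContinuousOn (fun t : ℝ => (1 + t ^ l) ^ r) (Ici 0) :=
  ((continuous_const.add (Real.continuous_rpow_const hl.le)).continuousOn).rpow_const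
    fun _ ht => Or.inl (add_pos_of_pos_of_nonneg one_pos (Real.rpow_nonneg ht l)).ne'

lemma one_add_rpow_rpow_le (hl : 0 < l) {r : ℝ} (hr : 0 ≤ r) (ht : 0 < t) :
    (1 + t ^ l) ^ (-(r / l)) ≤ t ^ (-r) := by
  calc (1 + t ^ l) ^ (-(r / l)) ≤ (t ^ l) ^ (-(r / l)) :=
        Real.rpow_le_rpow_of_nonpos (by positivity) (by linarith)
          (by simp only [neg_nonpos]; positivity)
    _ = t ^ (-r) := by rw [← Real.rpow_mul ht.le]; congr 1; field

lemma hasDerivAt_one_add_rpow_rpow (r : ℝ) (ht : 0 < t) :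
    HasDerivAt (fun t : ℝ => (1 + t ^ l) ^ r) (r * l * t ^ (l - 1) * (1 + t ^ l) ^ (r - 1)) t := by
  refine (((Real.hasDerivAt_rpow_const (Or.inl ht.ne')).const_add 1).rpow_const
    (Or.inl (by positivity))).congr_deriv ?_
  ring

lemma integrableOn_rpow_mul_blissDensity {s : ℝ} (hp : 1 < p) (hl : 0 < l) (hs : 0 ≤ s)
    (hsl : s ≤ l) : IntegrableOn (fun t => t ^ s * blissDensity p l t) (Ioi 0) := by
  have hc : ContinuousOn (fun t => t ^ s * blissDensity p l t) (Ici 0) :=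
    (Real.continuous_rpow_const hs).continuousOn.mul (continuousOn_one_add_rpow_rpow hl _)
  rw [← Ioc_union_Ioi_eq_Ioi zero_le_one]
  refine IntegrableOn.union ((hc.mono Icc_subset_Ici_self).integrableOn_Icc.mono_set
    Ioc_subset_Icc_self) ?_
  refine Integrable.mono' (g := fun t => t ^ (s - p * (1 + l)))
    (integrableOn_Ioi_rpow_of_lt (by nlinarith) one_pos)
    ((hc.mono (Ioi_subset_Ici zero_le_one)).aestronglyMeasurable measurableSet_Ioi) ?_
  filter_upwards [ae_restrict_mem measurableSet_Ioi] with t ht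
  have ht0 : 0 < t := one_pos.trans ht
  have := blissDensity_pos (p := p) (l := l) ht0.le
  rw [Real.norm_of_nonneg (by positivity), sub_eq_add_neg, Real.rpow_add ht0]
  gcongr
  exact one_add_rpow_rpow_le hl (by positivity) ht0

lemma integrableOn_blissDensity (hp : 1 < p) (hl : 0 < l) :
    IntegrableOn (blissDensity p l) (Ioi 0) := by
  simpa using integrableOn_rpow_mul_blissDensity hp hl le_rfl hl.le

lemma integral_rpow_mul_blissDensity_pos {s : ℝ} (hp : 1 < p) (hl : 0 < l) (hs : 0 ≤ s)
    (hsl : s ≤ l) : 0 < ∫ t in Ioi 0, t ^ s * blissDensity p l t := by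
  have hpos : ∀ t ∈ Ioi (0 : ℝ), 0 < t ^ s * blissDensity p l t := fun t ht =>
    mul_pos (Real.rpow_pos_of_pos ht s) (blissDensity_pos (le_of_lt ht))
  rw [setIntegral_pos_iff_support_of_nonneg_ae
    (ae_restrict_of_forall_mem measurableSet_Ioi fun t ht => (hpos t ht).le)
    (integrableOn_rpow_mul_blissDensity hp hl hs hsl),
    inter_eq_right.2 fun t ht => Function.mem_support.2 (hpos t ht).ne', Real.volume_Ioi]
  exact ENNReal.zero_lt_top

lemma integral_blissDensity_pos (hp : 1 < p) (hl : 0 < l) :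
    0 < ∫ t in Ioi 0, blissDensity p l t := by
  simpa only [Real.rpow_zero, one_mul] using
    integral_rpow_mul_blissDensity_pos hp hl le_rfl hl.le

lemma integral_blissDensity_eq (hp : 1 < p) (hl : 0 < l) :
    ∫ t in Ioi 0, blissDensity p l t =
      (p - 1) * (1 + l) * ∫ t in Ioi 0, t ^ l * blissDensity p l t := by
  set r := 1 - p * (1 + l) / l
  have hint := (integrableOn_blissDensity hp hl).sub
    ((integrableOn_rpow_mul_blissDensity hp hl hl.le le_rfl).const_mul ((p - 1) * (1 + l)))
  have hderiv : ∀ t ∈ Ioi (0 : ℝ), HasDerivAt (fun t => t * (1 + t ^ l) ^ r)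
      (blissDensity p l t - (p - 1) * (1 + l) * (t ^ l * blissDensity p l t)) t := by
    intro t ht
    have ht0 : (0 : ℝ) < t := ht
    refine ((hasDerivAt_id' t).mul (hasDerivAt_one_add_rpow_rpow r ht0)).congr_deriv ?_
    have hpow : (1 + t ^ l) ^ r = blissDensity p l t * (1 + t ^ l) := by
      rw [blissDensity, ← Real.rpow_add_one (by positivity)]
      simp only [r]
      ring_nf
    rw [hpow, Real.rpow_sub_one ht0.ne', Real.rpow_sub_one (by positivity), hpow]
    field
  have hlimit : Tendsto (fun t : ℝ => t * (1 + t ^ l) ^ r) atTop (𝓝 0) := by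
    have hexp : 0 < (p - 1) * (1 + l) := mul_pos (by linarith) (by linarith)
    refine squeeze_zero' ?_ ?_ (tendsto_rpow_neg_atTop hexp)
    · filter_upwards [eventually_gt_atTop 0] with t ht
      positivity
    · filter_upwards [eventually_gt_atTop 0] with t ht
      calc t * (1 + t ^ l) ^ r = t * (1 + t ^ l) ^ (-((p * (1 + l) - l) / l)) := by
            congr 2; field
        _ ≤ t * t ^ (-(p * (1 + l) - l)) := by
            gcongr; exact one_add_rpow_rpow_le hl (by nlinarith) ht
        _ = t ^ (-((p - 1) * (1 + l))) := by
            rw [← Real.rpow_one_add' ht.le (by nlinarith)]; congr 1; ring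
  have hcont : ContinuousWithinAt (fun t : ℝ => t * (1 + t ^ l) ^ r) (Ici 0) 0 :=
    (continuousOn_id.mul (continuousOn_one_add_rpow_rpow hl r)) 0 self_mem_Ici
  have hFTC := integral_Ioi_of_hasDerivAt_of_tendsto hcont hderiv hint hlimit
  rw [integral_sub (integrableOn_blissDensity hp hl)
    ((integrableOn_rpow_mul_blissDensity hp hl hl.le le_rfl).const_mul _), integral_const_mul,
    zero_mul, sub_zero] at hFTC
  exact sub_eq_zero.1 hFTC

lemma blissProfile_nonneg (hx : 0 ≤ x) : 0 ≤ blissProfile p l x := by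
  unfold blissProfile; positivity

lemma blissPeak_pos (hp : 1 < p) : 0 < blissPeak p l :=
  Real.rpow_pos_of_pos (inv_pos.2 (by linarith)) _

lemma blissProfile_rpow (hp : 0 < p) (hl : 0 < l) (hx : 0 < x) :
    blissProfile p l x ^ (p * l) = (1 + x ^ l)⁻¹ ^ (p - 1) * (1 - (1 + x ^ l)⁻¹) := by
  have hpos : 0 < 1 + x ^ l := by positivity
  rw [blissProfile, Real.mul_rpow (by positivity) (by positivity), ← Real.rpow_mul hx.le,
    ← Real.rpow_mul hpos.le, Real.inv_rpow hpos.le, Real.rpow_sub_one hpos.ne',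
    show 1 / p * (p * l) = l by field, show -(1 / l) * (p * l) = -p by field,
    Real.rpow_neg hpos.le]
  field

lemma inv_one_add_blissPeak_rpow (hp : 1 < p) (hl : 0 < l) :
    (1 + blissPeak p l ^ l)⁻¹ = (p - 1) / p := by
  have hp1 : 0 < p - 1 := by linarith
  rw [blissPeak, ← Real.rpow_mul (by positivity), one_div_mul_cancel hl.ne', Real.rpow_one]
  field

lemma div_le_inv_one_add_rpow (hp : 1 < p) (hl : 0 < l) (hx : 0 ≤ x) (hxp : x ≤ blissPeak p l) :
    (p - 1) / p ≤ (1 + x ^ l)⁻¹ := by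
  rw [← inv_one_add_blissPeak_rpow hp hl]
  gcongr

lemma inv_one_add_rpow_le_div (hp : 1 < p) (hl : 0 < l) (hxp : blissPeak p l ≤ x) :
    (1 + x ^ l)⁻¹ ≤ (p - 1) / p := by
  have := blissPeak_pos (l := l) hp
  rw [← inv_one_add_blissPeak_rpow hp hl]
  gcongr

lemma hasDerivAt_blissProfile (hp : 0 < p) (hl : 0 < l) (hx : 0 < x) :
    HasDerivAt (blissProfile p l)
      (blissProfile p l x / x * (1 / p - x ^ l * (1 + x ^ l)⁻¹)) x := by
  refine ((Real.hasDerivAt_rpow_const (Or.inl hx.ne')).mul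
    (hasDerivAt_one_add_rpow_rpow (-(1 / l)) hx)).congr_deriv ?_
  rw [blissProfile, Real.rpow_sub_one hx.ne', Real.rpow_sub_one hx.ne',
    Real.rpow_sub_one (by positivity)]
  field

lemma rpow_mul_blissProfile_deriv (hp : 0 < p) (hl : 0 < l) (hx : 0 < x) :
    p * (blissProfile p l x * (1 + x ^ l)⁻¹) ^ (p - 1) *
      (blissProfile p l x / x * (1 / p - x ^ l * (1 + x ^ l)⁻¹)) =
    blissDensity p l x - (p - 1) * (x ^ l * blissDensity p l x) := by
  have hpos : 0 < 1 + x ^ l := by positivity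
  have hprofile : (blissProfile p l x * (1 + x ^ l)⁻¹) ^ p = x * blissDensity p l x := by
    rw [blissProfile, mul_assoc, ← Real.rpow_neg_one, ← Real.rpow_add hpos,
      Real.mul_rpow (by positivity) (by positivity), ← Real.rpow_mul hx.le, ← Real.rpow_mul hpos.le,
      one_div_mul_cancel hp.ne', Real.rpow_one, blissDensity]
    congr 2
    field
  have hmul := rpow_sub_one_mul_self hp.ne'
    (mul_nonneg (blissProfile_nonneg (p := p) (l := l) hx.le) (inv_nonneg.2 hpos.le))
  rw [hprofile] at hmul
  calc _ = p * ((blissProfile p l x * (1 + x ^ l)⁻¹) ^ (p - 1) *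
        (blissProfile p l x * (1 + x ^ l)⁻¹)) * (1 + x ^ l) / x *
          (1 / p - x ^ l * (1 + x ^ l)⁻¹) := by field
    _ = _ := by rw [hmul]; field

lemma continuousOn_blissProfile (hp : 0 < p) (hl : 0 < l) :
    ContinuousOn (blissProfile p l) (Ici 0) :=
  (Real.continuous_rpow_const (by positivity)).continuousOn.mul
    (continuousOn_one_add_rpow_rpow hl _)

lemma tendsto_blissProfile_atTop (hp : 1 < p) (hl : 0 < l) :
    Tendsto (blissProfile p l) atTop (𝓝 0) := by
  have hexp : 0 < 1 - 1 / p := by rw [sub_pos, div_lt_one (by linarith)]; exact hp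
  refine squeeze_zero' ?_ ?_ (tendsto_rpow_neg_atTop hexp)
  · filter_upwards [eventually_ge_atTop 0] with x hx using blissProfile_nonneg hx
  · filter_upwards [eventually_gt_atTop 0] with x hx
    calc x ^ (1 / p) * (1 + x ^ l) ^ (-(1 / l)) ≤ x ^ (1 / p) * x ^ (-1 : ℝ) := by
          gcongr; exact one_add_rpow_rpow_le hl zero_le_one hx
      _ = x ^ (-(1 - 1 / p)) := by rw [← Real.rpow_add hx]; ring_nf

lemma hasDerivAt_integral_comp_blissProfile (hp : 1 < p) (hl : 0 < l) (hx : 0 < x) {σ : ℝ → ℝ}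
    (hσ : Continuous σ) (hσx : σ (blissProfile p l x) = (1 + x ^ l)⁻¹) :
    HasDerivAt (fun x => ∫ v in 0..blissProfile p l x, p * (v * σ v) ^ (p - 1))
      (blissDensity p l x - (p - 1) * (x ^ l * blissDensity p l x)) x := by
  have hp0 : 0 < p := by linarith
  have hcont := continuous_mul_mul_rpow_sub_one hp hσ
  have hprim := (hcont.integral_hasStrictDerivAt 0 (blissProfile p l x)).hasDerivAt
  refine (hprim.comp x (hasDerivAt_blissProfile hp0 hl hx)).congr_deriv ?_
  rw [hσx, rpow_mul_blissProfile_deriv hp0 hl hx]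

end BlissExtremal

section BlissInequality

variable {p l : ℝ}

lemma integral_rising_branch (hp : 1 < p) (hl : 0 < l) {σ : ℝ → ℝ} (hσ : Continuous σ)
    (hσx : ∀ x ∈ Ioo 0 (blissPeak p l), σ (blissProfile p l x) = (1 + x ^ l)⁻¹) :
    ∫ v in 0..blissProfile p l (blissPeak p l), p * (v * σ v) ^ (p - 1) =
      ∫ x in 0..blissPeak p l, (blissDensity p l x - (p - 1) * (x ^ l * blissDensity p l x)) := by
  have hp0 : 0 < p := by linarith
  have hpeak : 0 ≤ blissPeak p l := (blissPeak_pos hp).le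
  have hφ := continuous_mul_mul_rpow_sub_one hp hσ
  have hint := (integrableOn_blissDensity hp hl).sub
    ((integrableOn_rpow_mul_blissDensity hp hl hl.le le_rfl).const_mul (p - 1))
  have hcont : ContinuousOn (fun x => ∫ v in 0..blissProfile p l x, p * (v * σ v) ^ (p - 1))
      (Icc 0 (blissPeak p l)) :=
    (intervalIntegral.continuous_primitive
      (fun _ _ => hφ.intervalIntegrable _ _) 0).comp_continuousOn
      ((continuousOn_blissProfile hp0 hl).mono Icc_subset_Ici_self)
  have hFTC := intervalIntegral.integral_eq_sub_of_hasDerivAt_of_le hpeak hcont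
    (fun x hx => hasDerivAt_integral_comp_blissProfile hp hl hx.1 hσ (hσx x hx))
    ((intervalIntegrable_iff_integrableOn_Ioc_of_le hpeak).2 (hint.mono_set Ioc_subset_Ioi_self))
  have hzero : blissProfile p l 0 = 0 := by
    rw [blissProfile, Real.zero_rpow (one_div_ne_zero hp0.ne'), zero_mul]
  rw [hFTC, hzero, intervalIntegral.integral_same, sub_zero]

lemma integral_falling_branch (hp : 1 < p) (hl : 0 < l) {τ : ℝ → ℝ} (hτ : Continuous τ)
    (hτx : ∀ x ∈ Ioi (blissPeak p l), τ (blissProfile p l x) = (1 + x ^ l)⁻¹) :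
    ∫ v in 0..blissProfile p l (blissPeak p l), p * (v * τ v) ^ (p - 1) =
      -∫ x in Ioi (blissPeak p l),
        (blissDensity p l x - (p - 1) * (x ^ l * blissDensity p l x)) := by
  have hp0 : 0 < p := by linarith
  have hpeak : 0 < blissPeak p l := blissPeak_pos hp
  have hφ := continuous_mul_mul_rpow_sub_one hp hτ
  have hint := (integrableOn_blissDensity hp hl).sub
    ((integrableOn_rpow_mul_blissDensity hp hl hl.le le_rfl).const_mul (p - 1))
  have hprim : Continuous fun w => ∫ v in 0..w, p * (v * τ v) ^ (p - 1) :=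
    intervalIntegral.continuous_primitive (fun _ _ => hφ.intervalIntegrable _ _) 0
  have hcont : ContinuousOn (fun x => ∫ v in 0..blissProfile p l x, p * (v * τ v) ^ (p - 1))
      (Ici (blissPeak p l)) :=
    hprim.comp_continuousOn ((continuousOn_blissProfile hp0 hl).mono (Ici_subset_Ici.2 hpeak.le))
  have hlimit := (hprim.tendsto 0).comp (tendsto_blissProfile_atTop hp hl)
  rw [integral_Ioi_of_hasDerivAt_of_tendsto (hcont _ self_mem_Ici)
    (fun x hx => hasDerivAt_integral_comp_blissProfile hp hl (hpeak.trans hx) hτ (hτx x hx))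
    (hint.mono_set (Ioi_subset_Ioi hpeak.le)) hlimit, intervalIntegral.integral_same, zero_sub,
    neg_neg]

lemma integral_rising_sub_falling_branch (hp : 1 < p) (hl : 0 < l) {σ τ : ℝ → ℝ}
    (hσ : Continuous σ) (hτ : Continuous τ)
    (hσx : ∀ x ∈ Ioo 0 (blissPeak p l), σ (blissProfile p l x) = (1 + x ^ l)⁻¹)
    (hτx : ∀ x ∈ Ioi (blissPeak p l), τ (blissProfile p l x) = (1 + x ^ l)⁻¹) :
    ∫ v in 0..blissProfile p l (blissPeak p l),
        (p * (v * σ v) ^ (p - 1) - p * (v * τ v) ^ (p - 1)) =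
      (p - 1) * l * ∫ x in Ioi 0, x ^ l * blissDensity p l x := by
  have hpeak : 0 ≤ blissPeak p l := (blissPeak_pos hp).le
  have hD := integrableOn_blissDensity hp hl
  have hN := (integrableOn_rpow_mul_blissDensity hp hl hl.le le_rfl).const_mul (p - 1)
  have hint : IntegrableOn
      (fun x => blissDensity p l x - (p - 1) * (x ^ l * blissDensity p l x)) (Ioi 0) := hD.sub hN
  rw [intervalIntegral.integral_sub
    ((continuous_mul_mul_rpow_sub_one hp hσ).intervalIntegrable _ _)
    ((continuous_mul_mul_rpow_sub_one hp hτ).intervalIntegrable _ _),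
    integral_rising_branch hp hl hσ hσx, integral_falling_branch hp hl hτ hτx,
    sub_neg_eq_add, intervalIntegral.integral_of_le hpeak,
    ← setIntegral_union (Ioc_disjoint_Ioi le_rfl) measurableSet_Ioi
      (hint.mono_set Ioc_subset_Ioi_self) (hint.mono_set (Ioi_subset_Ioi hpeak)),
    Ioc_union_Ioi_eq_Ioi hpeak, integral_sub hD hN, integral_const_mul,
    integral_blissDensity_eq hp hl]
  ring

lemma rpow_mem_Icc_of_mem_Icc_blissProfile_blissPeak (hp : 1 < p) (hl : 0 < l) {v : ℝ}
    (hv : v ∈ Icc 0 (blissProfile p l (blissPeak p l))) :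
    v ^ (p * l) ∈ Icc 0 (((p - 1) / p) ^ (p - 1) * (1 - (p - 1) / p)) := by
  have hp0 : 0 < p := by linarith
  rw [← inv_one_add_blissPeak_rpow hp hl, ← blissProfile_rpow hp0 hl (blissPeak_pos hp)]
  exact ⟨Real.rpow_nonneg hv.1 _, Real.rpow_le_rpow hv.1 hv.2 (by positivity)⟩

lemma exists_blissProfile_calibration (hp : 1 < p) (hl : 0 < l) :
    ∃ σ τ : ℝ → ℝ, Continuous σ ∧ Continuous τ ∧
      (∀ v ∈ Icc 0 (blissProfile p l (blissPeak p l)),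
        0 ≤ σ v ∧ σ v ^ (p - 1) * (1 - σ v) = v ^ (p * l)) ∧
      (∀ v ∈ Icc 0 (blissProfile p l (blissPeak p l)),
        0 ≤ τ v ∧ τ v ^ (p - 1) * (1 - τ v) = v ^ (p * l)) ∧
      ∫ v in 0..blissProfile p l (blissPeak p l),
          (p * (v * σ v) ^ (p - 1) - p * (v * τ v) ^ (p - 1)) =
        (p - 1) * l * ∫ x in Ioi 0, x ^ l * blissDensity p l x := by
  have hp0 : 0 < p := by linarith
  have hp1 : 0 < p - 1 := by linarith
  have hpeak := blissPeak_pos (l := l) hp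
  have hcrit : 0 ≤ (p - 1) / p ∧ (p - 1) / p ≤ 1 :=
    ⟨by positivity, (div_le_one hp0).2 (by linarith)⟩
  obtain ⟨σ, hσ, hσleft, hσright⟩ := exists_continuous_inverse_of_strictAntiOn hcrit.2
    (continuous_rpow_mul_one_sub hp).continuousOn (strictAntiOn_rpow_mul_one_sub hp)
  obtain ⟨τ, hτ, hτleft, hτright⟩ := exists_continuous_inverse_of_strictMonoOn hcrit.1
    (continuous_rpow_mul_one_sub hp).continuousOn (strictMonoOn_rpow_mul_one_sub hp)
  have hpow : Continuous fun v : ℝ => v ^ (p * l) := Real.continuous_rpow_const (by positivity)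
  refine ⟨fun v => σ (v ^ (p * l)), fun v => τ (v ^ (p * l)), hσ.comp hpow, hτ.comp hpow,
    fun v hv => ?_, fun v hv => ?_, ?_⟩
  · obtain ⟨hmem, heq⟩ := hσright (v ^ (p * l))
      (by simpa using rpow_mem_Icc_of_mem_Icc_blissProfile_blissPeak hp hl hv)
    exact ⟨hcrit.1.trans hmem.1, heq⟩
  · obtain ⟨hmem, heq⟩ := hτright (v ^ (p * l))
      (by simpa [Real.zero_rpow hp1.ne'] using
        rpow_mem_Icc_of_mem_Icc_blissProfile_blissPeak hp hl hv)
    exact ⟨hmem.1, heq⟩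
  · refine integral_rising_sub_falling_branch hp hl (hσ.comp hpow) (hτ.comp hpow)
      (fun x hx => ?_) fun x hx => ?_
    · rw [blissProfile_rpow hp0 hl hx.1]
      exact hσleft _ ⟨div_le_inv_one_add_rpow hp hl hx.1.le hx.2.le,
        inv_le_one_of_one_le₀ (by have := Real.rpow_pos_of_pos hx.1 l; linarith)⟩
    · have hx0 : 0 < x := hpeak.trans hx
      rw [blissProfile_rpow hp0 hl hx0]
      exact hτleft _ ⟨by positivity, inv_one_add_rpow_le_div hp hl (le_of_lt hx)⟩

end BlissInequality

section Interval

variable {p a b : ℝ} {h : ℝ → ℝ}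

lemma exists_calibration_le (hp : 1 < p) (ha : 0 < a) (hab : a ≤ b)
    (hint : IntervalIntegrable h volume a b)
    (hhp : IntervalIntegrable (fun x => h x ^ p) volume a b) (hh : ∀ x ∈ Icc a b, 0 ≤ h x) :
    ∃ m, 0 ≤ m ∧ (∀ x ∈ Icc a b, rescaledPrimitive p (fun x => ∫ t in a..x, h t) x ≤ m) ∧
      ∀ (q C : ℝ) (σ τ : ℝ → ℝ), 0 < q → Continuous σ → Continuous τ →
        (∀ v ∈ Icc 0 m, 0 ≤ σ v ∧ σ v ^ (p - 1) * (1 - σ v) = C * v ^ (q - p)) →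
        (∀ v ∈ Icc 0 m, 0 ≤ τ v ∧ τ v ^ (p - 1) * (1 - τ v) = C * v ^ (q - p)) →
        (∫ v in 0..m, (p * (v * σ v) ^ (p - 1) - p * (v * τ v) ^ (p - 1))) +
          (p - 1) * C * ∫ x in a..b, (∫ t in a..x, h t) ^ q * x ^ (-1 - q * ((p - 1) / p)) ≤
          ∫ x in a..b, h x ^ p := by
  have hF : AbsolutelyContinuousOnInterval (fun x => ∫ t in a..x, h t) a b :=
    hint.absolutelyContinuousOnInterval_intervalIntegral left_mem_uIcc
  have hF0 : ∀ x ∈ Icc a b, 0 ≤ ∫ t in a..x, h t := fun x hx =>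
    intervalIntegral.integral_nonneg hx.1 fun t ht => hh t ⟨ht.1, ht.2.trans hx.2⟩
  have hcont := (absolutelyContinuousOnInterval_rescaledPrimitive (p := p) ha
    (ha.trans_le hab) hF).continuousOn
  rw [uIcc_of_le hab] at hcont
  obtain ⟨c, hc, hmax⟩ := isCompact_Icc.exists_isMaxOn (nonempty_Icc.2 hab) hcont
  refine ⟨_, rescaledPrimitive_nonneg (ha.le.trans hc.1) (hF0 c hc), fun x hx => hmax hx, ?_⟩
  intro q C σ τ hq hσ hτ hσC hτC
  exact integral_rpow_ge_of_calibration hp hq ha hc hF intervalIntegral.integral_same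
    (hint.ae_hasDerivAt_integral.mono fun x hx hxab => hx hxab a left_mem_uIcc) hF0 hh hhp rfl
    (fun x hx => hmax hx) hσ hτ hσC hτC

lemma hardy_interval (hp : 1 < p) (ha : 0 < a) (hab : a ≤ b)
    (hint : IntervalIntegrable h volume a b)
    (hhp : IntervalIntegrable (fun x => h x ^ p) volume a b) (hh : ∀ x ∈ Icc a b, 0 ≤ h x) :
    ∫ x in a..b, (∫ t in a..x, h t) ^ p * x ^ (-1 - p * ((p - 1) / p)) ≤
      (p / (p - 1)) ^ p * ∫ x in a..b, h x ^ p := by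
  have hp0 : 0 < p := by linarith
  have hp1 : 0 < p - 1 := by linarith
  obtain ⟨m, -, -, hcal⟩ := exists_calibration_le hp ha hab hint hhp hh
  have hroot : ∀ v ∈ Icc 0 m, 0 ≤ (p - 1) / p ∧
      ((p - 1) / p) ^ (p - 1) * (1 - (p - 1) / p) = (((p - 1) / p) ^ p / (p - 1)) * v ^ (p - p) :=
    fun v _ => ⟨by positivity, by
      rw [sub_self, Real.rpow_zero, ← rpow_sub_one_mul_self hp0.ne' (by positivity)]; field⟩
  have hcal := hcal p _ _ _ hp0 continuous_const continuous_const hroot hroot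
  simp only [sub_self, intervalIntegral.integral_zero, zero_add] at hcal
  have hinv : ((p - 1) / p) ^ p = ((p / (p - 1)) ^ p)⁻¹ := by
    rw [← Real.inv_rpow (by positivity), inv_div]
  rwa [mul_div_cancel₀ _ hp1.ne', hinv, inv_mul_le_iff₀ (by positivity)] at hcal

end Interval

section Bliss

variable {p l a b : ℝ} {h : ℝ → ℝ}

/-- The constant `∫ x ^ l D / (∫ D) ^ (1 + l)` in Bliss' inequality, where `D` is
`blissDensity p l`. -/
def blissConst (p l : ℝ) : ℝ :=
  (∫ t in Ioi 0, t ^ l * blissDensity p l t) / (∫ t in Ioi 0, blissDensity p l t) ^ (1 + l)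

lemma blissConst_pos (hp : 1 < p) (hl : 0 < l) : 0 < blissConst p l := by
  have hD := integral_blissDensity_pos hp hl
  exact div_pos (integral_rpow_mul_blissDensity_pos hp hl hl.le le_rfl) (by positivity)

lemma integral_branches_comp_div (hp : p ≠ 0) {μ m : ℝ} (hμ : 0 < μ) (hm : 0 ≤ m) {σ τ : ℝ → ℝ}
    (hσ : ∀ v ∈ Icc 0 m, 0 ≤ σ v) (hτ : ∀ v ∈ Icc 0 m, 0 ≤ τ v) :
    ∫ v in 0..μ * m, (p * (v * σ (v / μ)) ^ (p - 1) - p * (v * τ (v / μ)) ^ (p - 1)) =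
      μ ^ p * ∫ v in 0..m, (p * (v * σ v) ^ (p - 1) - p * (v * τ v) ^ (p - 1)) := by
  have hscale : ∀ v ∈ uIcc 0 m,
      p * (μ * v * σ (μ * v / μ)) ^ (p - 1) - p * (μ * v * τ (μ * v / μ)) ^ (p - 1) =
        μ ^ (p - 1) * (p * (v * σ v) ^ (p - 1) - p * (v * τ v) ^ (p - 1)) := fun v hv => by
    rw [uIcc_of_le hm] at hv
    rw [mul_div_cancel_left₀ v hμ.ne', mul_assoc μ, mul_assoc μ,
      Real.mul_rpow hμ.le (mul_nonneg hv.1 (hσ v hv)),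
      Real.mul_rpow hμ.le (mul_nonneg hv.1 (hτ v hv))]
    ring
  have hsubst : ∀ g : ℝ → ℝ, ∫ v in 0..μ * m, g v = μ * ∫ v in 0..m, g (μ * v) := fun g => by
    rw [intervalIntegral.mul_integral_comp_mul_left, mul_zero]
  rw [hsubst, intervalIntegral.integral_congr hscale, intervalIntegral.integral_const_mul,
    ← mul_assoc, mul_comm μ, rpow_sub_one_mul_self hp hμ.le]

-- Weighted AM-GM; the choice of `s` only enters through the products that cancel it.
lemma le_mul_rpow_of_mul_rpow_neg_add_mul_le {c s N N₀ E : ℝ} (hc : 0 < c) (hl : 0 < l)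
    (hs : 0 < s) (hN : 0 ≤ N) (hN₀ : 0 < N₀) (hE : c * (N * s ^ (-l) + l * N₀ * s) ≤ E) :
    N ≤ N₀ / (c * (1 + l) * N₀) ^ (1 + l) * E ^ (1 + l) := by
  have amgm := Real.geom_mean_le_arith_mean2_weighted (w₁ := 1 / (1 + l)) (w₂ := l / (1 + l))
    (p₁ := N * s ^ (-l)) (p₂ := N₀ * s) (by positivity) (by positivity) (by positivity)
    (by positivity) (by field)
  have hmean : 1 / (1 + l) * (N * s ^ (-l)) + l / (1 + l) * (N₀ * s) ≤ E / (c * (1 + l)) := by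
    rw [le_div_iff₀ (by positivity)]
    refine le_trans (le_of_eq ?_) hE
    field
  have hprod : ((N * s ^ (-l)) ^ (1 / (1 + l)) * (N₀ * s) ^ (l / (1 + l))) ^ (1 + l) =
      N * N₀ ^ l := by
    rw [Real.mul_rpow (by positivity) (by positivity), ← Real.rpow_mul (by positivity),
      ← Real.rpow_mul (by positivity), one_div_mul_cancel (by positivity),
      div_mul_cancel₀ _ (by positivity), Real.rpow_one, Real.mul_rpow hN₀.le hs.le,
      Real.rpow_neg hs.le]
    field
  have hpow : N * N₀ ^ l ≤ (E / (c * (1 + l))) ^ (1 + l) := by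
    rw [← hprod]
    exact Real.rpow_le_rpow (by positivity) (amgm.trans hmean) (by positivity)
  have hE0 : 0 ≤ E := le_trans (by positivity) hE
  rw [Real.div_rpow hE0 (by positivity), ← le_div_iff₀ (by positivity)] at hpow
  refine hpow.trans_eq ?_
  rw [Real.mul_rpow (by positivity) hN₀.le, add_comm 1 l, Real.rpow_add_one hN₀.ne']
  field

lemma exists_calibration_of_pos (hp : 1 < p) (hl : 0 < l) {m : ℝ} (hm : 0 < m) :
    ∃ (s : ℝ) (σ τ : ℝ → ℝ), 0 < s ∧ Continuous σ ∧ Continuous τ ∧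
      (∀ v ∈ Icc 0 m, 0 ≤ σ v ∧ σ v ^ (p - 1) * (1 - σ v) = s ^ (-l) * v ^ (p * (1 + l) - p)) ∧
      (∀ v ∈ Icc 0 m, 0 ≤ τ v ∧ τ v ^ (p - 1) * (1 - τ v) = s ^ (-l) * v ^ (p * (1 + l) - p)) ∧
      ∫ v in 0..m, (p * (v * σ v) ^ (p - 1) - p * (v * τ v) ^ (p - 1)) =
        s * ((p - 1) * l * ∫ x in Ioi 0, x ^ l * blissDensity p l x) := by
  obtain ⟨σ, τ, hσ, hτ, hσC, hτC, hint⟩ := exists_blissProfile_calibration hp hl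
  have hm₀ : 0 < blissProfile p l (blissPeak p l) := by
    have := blissPeak_pos (l := l) hp
    unfold blissProfile
    positivity
  obtain ⟨μ, hμ, rfl⟩ : ∃ μ, 0 < μ ∧ μ * blissProfile p l (blissPeak p l) = m :=
    ⟨_, div_pos hm hm₀, div_mul_cancel₀ m hm₀.ne'⟩
  have hrescale : ∀ {ρ : ℝ → ℝ}, (∀ v ∈ Icc 0 (blissProfile p l (blissPeak p l)),
        0 ≤ ρ v ∧ ρ v ^ (p - 1) * (1 - ρ v) = v ^ (p * l)) →
      ∀ v ∈ Icc 0 (μ * blissProfile p l (blissPeak p l)),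
        0 ≤ ρ (v / μ) ∧ ρ (v / μ) ^ (p - 1) * (1 - ρ (v / μ)) =
          (μ ^ p) ^ (-l) * v ^ (p * (1 + l) - p) := fun hρ v hv => by
    obtain ⟨hnonneg, heq⟩ := hρ (v / μ) ⟨div_nonneg hv.1 hμ.le, (div_le_iff₀' hμ).2 hv.2⟩
    refine ⟨hnonneg, heq.trans ?_⟩
    rw [Real.div_rpow hv.1 hμ.le, ← Real.rpow_mul hμ.le, mul_neg, Real.rpow_neg hμ.le]
    ring_nf
  refine ⟨μ ^ p, fun v => σ (v / μ), fun v => τ (v / μ), Real.rpow_pos_of_pos hμ p,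
    hσ.comp (continuous_id.div_const μ), hτ.comp (continuous_id.div_const μ),
    hrescale hσC, hrescale hτC, ?_⟩
  rw [integral_branches_comp_div (by linarith) hμ hm₀.le (fun v hv => (hσC v hv).1)
    (fun v hv => (hτC v hv).1), hint]

lemma bliss_interval (hp : 1 < p) (hl : 0 < l) (ha : 0 < a) (hab : a ≤ b)
    (hint : IntervalIntegrable h volume a b)
    (hhp : IntervalIntegrable (fun x => h x ^ p) volume a b) (hh : ∀ x ∈ Icc a b, 0 ≤ h x) :
    ∫ x in a..b, (∫ t in a..x, h t) ^ (p * (1 + l)) * x ^ (-1 - p * (1 + l) * ((p - 1) / p)) ≤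
      blissConst p l * (∫ x in a..b, h x ^ p) ^ (1 + l) := by
  have hq : 0 < p * (1 + l) := by nlinarith
  obtain ⟨m, hm, hum, hcal⟩ := exists_calibration_le hp ha hab hint hhp hh
  have hF0 : ∀ x ∈ Icc a b, 0 ≤ ∫ t in a..x, h t := fun x hx =>
    intervalIntegral.integral_nonneg hx.1 fun t ht => hh t ⟨ht.1, ht.2.trans hx.2⟩
  rcases hm.eq_or_lt with rfl | hm0
  · have hzero : ∀ x ∈ uIcc a b, (∫ t in a..x, h t) ^ (p * (1 + l)) *
        x ^ (-1 - p * (1 + l) * ((p - 1) / p)) = 0 := fun x hx => by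
      rw [uIcc_of_le hab] at hx
      have hx0 : 0 < x := ha.trans_le hx.1
      rw [← rescaledPrimitive_rpow_div (F := fun x => ∫ t in a..x, h t) hx0 (hF0 x hx),
        (hum x hx).antisymm (rescaledPrimitive_nonneg hx0.le (hF0 x hx)),
        Real.zero_rpow hq.ne', zero_div]
    rw [intervalIntegral.integral_congr hzero, intervalIntegral.integral_zero]
    exact mul_nonneg (blissConst_pos hp hl).le (Real.rpow_nonneg
      (intervalIntegral.integral_nonneg hab fun x hx => Real.rpow_nonneg (hh x hx) p) _)
  · obtain ⟨s, σ, τ, hs, hσ, hτ, hσC, hτC, hbranches⟩ := exists_calibration_of_pos hp hl hm0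
    have hlower := hcal (p * (1 + l)) _ σ τ hq hσ hτ hσC hτC
    rw [blissConst, integral_blissDensity_eq hp hl]
    refine le_mul_rpow_of_mul_rpow_neg_add_mul_le (sub_pos.2 hp) hl hs
      (intervalIntegral.integral_nonneg hab fun x hx => mul_nonneg (Real.rpow_nonneg (hF0 x hx) _)
        (Real.rpow_nonneg (ha.le.trans hx.1) _))
      (integral_rpow_mul_blissDensity_pos hp hl hl.le le_rfl) (le_trans (le_of_eq ?_) hlower)
    rw [hbranches]
    ring

end Bliss

section Truncation

variable {p q r s : ℝ} {K a b : ℝ}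

lemma measurable_lintegral_Ioo {f : ℝ → ℝ≥0∞} (hf : Measurable f) (a : ℝ) :
    Measurable fun x => ∫⁻ t in Ioo a x, f t := by
  have hset : MeasurableSet {z : ℝ × ℝ | z.2 ∈ Ioo a z.1} :=
    (measurableSet_lt measurable_const measurable_snd).inter
      (measurableSet_lt measurable_snd measurable_fst)
  simp only [← lintegral_indicator measurableSet_Ioo]
  exact ((hf.comp measurable_snd).indicator hset).lintegral_prod_right'

/-- Restriction of `f` to `(1 / (n + 1), n + 1]`, cut off at height `n`. -/
def truncate (f : ℝ → ℝ≥0∞) (n : ℕ) : ℝ → ℝ≥0∞ :=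
  (Ioc (1 / (n + 1 : ℝ)) (n + 1)).indicator fun t => min (f t) n

lemma monotone_Ioc_one_div : Monotone fun n : ℕ => Ioc (1 / (n + 1 : ℝ)) (n + 1) :=
  fun m n hmn => Ioc_subset_Ioc (by gcongr) (by gcongr)

lemma monotone_truncate (f : ℝ → ℝ≥0∞) : Monotone (truncate f) := fun m n hmn t =>
  (indicator_le_indicator_of_subset (monotone_Ioc_one_div hmn) (fun _ => zero_le) t).trans
    (indicator_le_indicator (min_le_min_left _ (by gcongr)))

lemma eventually_mem_Ioc_one_div {t : ℝ} (ht : 0 < t) :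
    ∀ᶠ n : ℕ in atTop, t ∈ Ioc (1 / (n + 1 : ℝ)) (n + 1) := by
  filter_upwards [tendsto_one_div_add_atTop_nhds_zero_nat.eventually_lt_const ht,
    (tendsto_atTop_add_const_right _ 1 tendsto_natCast_atTop_atTop).eventually_ge_atTop t]
    with n h1 h2 using ⟨h1, h2⟩

lemma tendsto_truncate (f : ℝ → ℝ≥0∞) {t : ℝ} (ht : 0 < t) :
    Tendsto (fun n => truncate f n t) atTop (𝓝 (f t)) := by
  have hmin : Tendsto (fun n : ℕ => min (f t) n) atTop (𝓝 (min (f t) ⊤)) :=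
    Tendsto.min tendsto_const_nhds ENNReal.tendsto_nat_nhds_top
  rw [min_top_right] at hmin
  refine hmin.congr' ?_
  filter_upwards [eventually_mem_Ioc_one_div ht] with n hn
  rw [truncate, indicator_of_mem hn]

lemma measurable_truncate {f : ℝ → ℝ≥0∞} (hf : Measurable f) (n : ℕ) :
    Measurable (truncate f n) :=
  (hf.min measurable_const).indicator measurableSet_Ioc

lemma truncate_le (f : ℝ → ℝ≥0∞) (n : ℕ) (t : ℝ) : truncate f n t ≤ f t :=
  indicator_le' (fun _ _ => min_le_left _ _) (fun _ _ => zero_le) t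

lemma truncate_le_natCast (f : ℝ → ℝ≥0∞) (n : ℕ) (t : ℝ) : truncate f n t ≤ n :=
  indicator_le' (fun _ _ => min_le_right _ _) (fun _ _ => zero_le) t

lemma lintegral_Ioo_truncate (f : ℝ → ℝ≥0∞) (n : ℕ) (x : ℝ) :
    ∫⁻ t in Ioo 0 x, truncate f n t = ∫⁻ t in Ioo (1 / (n + 1 : ℝ)) x, truncate f n t := by
  have hset : Ioc (1 / (n + 1 : ℝ)) (n + 1) ∩ Ioo 0 x =
      Ioc (1 / (n + 1 : ℝ)) (n + 1) ∩ Ioo (1 / (n + 1 : ℝ)) x := by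
    ext t
    have : 0 < 1 / (n + 1 : ℝ) := by positivity
    grind
  rw [truncate, setLIntegral_indicator measurableSet_Ioc, setLIntegral_indicator measurableSet_Ioc,
    hset]

lemma intervalIntegrable_rpow_of_bounded {h : ℝ → ℝ} {M : ℝ} (hr : 0 ≤ r) (hm : Measurable h)
    (hh : ∀ x, 0 ≤ h x) (hM : ∀ x, h x ≤ M) :
    IntervalIntegrable (fun x => h x ^ r) volume a b :=
  (intervalIntegrable_const (c := M ^ r)).mono_fun' (hm.pow_const r).aestronglyMeasurable
    (ae_of_all _ fun x => by
      dsimp only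
      rw [Real.norm_of_nonneg (Real.rpow_nonneg (hh x) r)]
      exact Real.rpow_le_rpow (hh x) (hM x) hr)

lemma ofReal_intervalIntegral_eq_lintegral {h : ℝ → ℝ} (hab : a ≤ b)
    (hint : IntervalIntegrable h volume a b) (hh : ∀ x ∈ Ioc a b, 0 ≤ h x) :
    ENNReal.ofReal (∫ x in a..b, h x) = ∫⁻ x in Ioc a b, ENNReal.ofReal (h x) := by
  rw [intervalIntegral.integral_of_le hab]
  exact ofReal_integral_eq_lintegral_ofReal
    ((intervalIntegrable_iff_integrableOn_Ioc_of_le hab).1 hint)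
    (ae_restrict_of_forall_mem measurableSet_Ioc hh)

lemma lintegral_primitive_rpow_le_of_intervalIntegral_le (hp : 0 ≤ p) (hq : 0 ≤ q) (hr : 0 ≤ r)
    (hK : 0 ≤ K) (ha : 0 < a) (hab : a ≤ b) {h : ℝ → ℝ} {M : ℝ} (hm : Measurable h)
    (hh : ∀ x, 0 ≤ h x) (hM : ∀ x, h x ≤ M)
    (hle : ∫ x in a..b, (∫ t in a..x, h t) ^ q * x ^ s ≤ K * (∫ x in a..b, h x ^ p) ^ r) :
    ∫⁻ x in Ioc a b, (∫⁻ t in Ioo a x, ENNReal.ofReal (h t)) ^ q * ENNReal.ofReal (x ^ s) ≤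
      ENNReal.ofReal K * (∫⁻ x in Ioc a b, ENNReal.ofReal (h x) ^ p) ^ r := by
  have hint : ∀ x, IntervalIntegrable h volume a x := fun x => by
    simpa only [Real.rpow_one] using intervalIntegrable_rpow_of_bounded zero_le_one hm hh hM
  have hF0 : ∀ x ∈ Ioc a b, 0 ≤ ∫ t in a..x, h t := fun x hx =>
    intervalIntegral.integral_nonneg hx.1.le fun t _ => hh t
  have hF : ContinuousOn (fun x => ∫ t in a..x, h t) (uIcc a b) :=
    intervalIntegral.continuousOn_primitive_interval' (hint b) left_mem_uIcc
  have hleft : ∫⁻ x in Ioc a b, (∫⁻ t in Ioo a x, ENNReal.ofReal (h t)) ^ q *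
      ENNReal.ofReal (x ^ s) = ENNReal.ofReal (∫ x in a..b, (∫ t in a..x, h t) ^ q * x ^ s) := by
    rw [ofReal_intervalIntegral_eq_lintegral hab
      (intervalIntegrable_rpow_mul_rpow hq ha (ha.trans_le hab) hF s) fun x hx =>
        mul_nonneg (Real.rpow_nonneg (hF0 x hx) q) (Real.rpow_nonneg (ha.trans hx.1).le s)]
    refine setLIntegral_congr_fun measurableSet_Ioc fun x hx => ?_
    rw [ENNReal.ofReal_mul (Real.rpow_nonneg (hF0 x hx) q),
      ← ENNReal.ofReal_rpow_of_nonneg (hF0 x hx) hq,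
      ofReal_intervalIntegral_eq_lintegral hx.1.le (hint x) fun t _ => hh t,
      setLIntegral_congr Ioo_ae_eq_Ioc]
  have hright : ∫⁻ x in Ioc a b, ENNReal.ofReal (h x) ^ p =
      ENNReal.ofReal (∫ x in a..b, h x ^ p) := by
    rw [ofReal_intervalIntegral_eq_lintegral hab (intervalIntegrable_rpow_of_bounded hp hm hh hM)
      fun x _ => Real.rpow_nonneg (hh x) p]
    exact lintegral_congr fun x => ENNReal.ofReal_rpow_of_nonneg (hh x) hp
  rw [hleft, hright, ENNReal.ofReal_rpow_of_nonneg (intervalIntegral.integral_nonneg hab fun x _ =>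
    Real.rpow_nonneg (hh x) p) hr, ← ENNReal.ofReal_mul hK]
  exact ENNReal.ofReal_le_ofReal hle

lemma lintegral_primitive_rpow_mul_le_of_truncate (hq : 0 ≤ q) {f w : ℝ → ℝ≥0∞} {R : ℝ≥0∞}
    (hf : Measurable f) (hw : Measurable w) (hw_top : ∀ x, w x ≠ ⊤)
    (hle : ∀ n : ℕ, ∫⁻ x in Ioc (1 / (n + 1 : ℝ)) (n + 1),
      (∫⁻ t in Ioo 0 x, truncate f n t) ^ q * w x ≤ R) :
    ∫⁻ x in Ioi 0, (∫⁻ t in Ioo 0 x, f t) ^ q * w x ≤ R := by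
  set G : ℕ → ℝ → ℝ≥0∞ := fun n => (Ioc (1 / (n + 1 : ℝ)) (n + 1)).indicator fun x =>
    (∫⁻ t in Ioo 0 x, truncate f n t) ^ q * w x
  have hG_meas : ∀ n, AEMeasurable (G n) (volume.restrict (Ioi 0)) := fun n =>
    ((((measurable_lintegral_Ioo (measurable_truncate hf n) 0).pow_const q).mul hw).indicator
      measurableSet_Ioc).aemeasurable
  have hG_mono : ∀ x, Monotone fun n => G n x := fun x m n hmn => by
    refine (indicator_le_indicator_of_subset (monotone_Ioc_one_div hmn) (fun _ => zero_le) x).trans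
      (indicator_le_indicator ?_)
    gcongr with t
    exact monotone_truncate f hmn t
  have hG_lim : ∀ x ∈ Ioi (0 : ℝ), Tendsto (fun n => G n x) atTop
      (𝓝 ((∫⁻ t in Ioo 0 x, f t) ^ q * w x)) := fun x hx => by
    have hinner : Tendsto (fun n => ∫⁻ t in Ioo 0 x, truncate f n t) atTop
        (𝓝 (∫⁻ t in Ioo 0 x, f t)) :=
      lintegral_tendsto_of_tendsto_of_monotone (fun n => (measurable_truncate hf n).aemeasurable)
        (ae_of_all _ fun t m n hmn => monotone_truncate f hmn t)
        (ae_restrict_of_forall_mem measurableSet_Ioo fun t ht => tendsto_truncate f ht.1)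
    refine (ENNReal.Tendsto.mul_const ((ENNReal.continuous_rpow_const.tendsto _).comp hinner)
      (Or.inr (hw_top x))).congr' ?_
    filter_upwards [eventually_mem_Ioc_one_div hx] with n hn
    simp only [G, indicator_of_mem hn, Function.comp_apply]
  refine le_of_tendsto' (lintegral_tendsto_of_tendsto_of_monotone hG_meas (ae_of_all _ hG_mono)
    (ae_restrict_of_forall_mem measurableSet_Ioi hG_lim)) fun n => ?_
  rw [setLIntegral_indicator measurableSet_Ioc]
  exact (lintegral_mono_set inter_subset_left).trans (hle n)

lemma lintegral_primitive_rpow_le_of_forall_interval (hp : 0 ≤ p) (hq : 0 ≤ q) (hr : 0 ≤ r)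
    (hK : 0 ≤ K)
    (hle : ∀ {a b : ℝ} {h : ℝ → ℝ}, 0 < a → a ≤ b → IntervalIntegrable h volume a b →
      IntervalIntegrable (fun x => h x ^ p) volume a b → (∀ x ∈ Icc a b, 0 ≤ h x) →
      ∫ x in a..b, (∫ t in a..x, h t) ^ q * x ^ s ≤ K * (∫ x in a..b, h x ^ p) ^ r)
    {f : ℝ → ℝ≥0∞} (hf : Measurable f) :
    ∫⁻ x in Ioi 0, (∫⁻ t in Ioo 0 x, f t) ^ q * ENNReal.ofReal (x ^ s) ≤
      ENNReal.ofReal K * (∫⁻ x in Ioi 0, f x ^ p) ^ r := by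
  refine lintegral_primitive_rpow_mul_le_of_truncate hq hf (by fun_prop)
    (fun _ => ENNReal.ofReal_ne_top) fun n => ?_
  have ha : (0 : ℝ) < 1 / (n + 1) := by positivity
  have hab : 1 / (n + 1 : ℝ) ≤ n + 1 :=
    (div_le_one_of_le₀ (by linarith [n.cast_nonneg (α := ℝ)]) (by positivity)).trans
      (by linarith [n.cast_nonneg (α := ℝ)])
  have hsub : Ioc (1 / (n + 1 : ℝ)) (n + 1) ⊆ Ioi 0 := fun x hx => ha.trans hx.1
  have hM : ∀ t, (truncate f n t).toReal ≤ n := fun t =>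
    ENNReal.toReal_le_of_le_ofReal n.cast_nonneg
      (by rw [ENNReal.ofReal_natCast]; exact truncate_le_natCast f n t)
  have hm : Measurable fun t => (truncate f n t).toReal := (measurable_truncate hf n).ennreal_toReal
  have hint : ∀ {r : ℝ}, 0 ≤ r → IntervalIntegrable (fun t => (truncate f n t).toReal ^ r) volume
    (1 / (n + 1 : ℝ)) (n + 1) := fun hr =>
      intervalIntegrable_rpow_of_bounded hr hm (fun _ => ENNReal.toReal_nonneg) hM
  have hbounded := lintegral_primitive_rpow_le_of_intervalIntegral_le hp hq hr hK ha hab hm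
    (fun _ => ENNReal.toReal_nonneg) hM (hle ha hab
      (by simpa only [Real.rpow_one] using hint zero_le_one) (hint hp)
      fun _ _ => ENNReal.toReal_nonneg)
  have hreal : ∀ t, ENNReal.ofReal (truncate f n t).toReal = truncate f n t := fun t =>
    ENNReal.ofReal_toReal ((truncate_le_natCast f n t).trans_lt (ENNReal.natCast_lt_top n)).ne
  simp only [hreal, ← lintegral_Ioo_truncate] at hbounded
  refine hbounded.trans ?_
  gcongr with x
  exact truncate_le f n x

end Truncation

section BlissFactor
variable {p q l : ℝ}

lemma hasDerivAt_one_sub_inv_one_add_rpow {x : ℝ} (hx : 0 < x) :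
    HasDerivAt (fun x : ℝ => 1 - (1 + x ^ l)⁻¹) (l * x ^ (l - 1) / (1 + x ^ l) ^ 2) x := by
  have hpos : (0 : ℝ) < 1 + x ^ l := by positivity
  refine ((((Real.hasDerivAt_rpow_const (Or.inl hx.ne')).const_add 1).inv
    hpos.ne').const_sub 1).congr_deriv ?_
  ring

lemma bijOn_one_sub_inv_one_add_rpow (hl : 0 < l) :
    BijOn (fun x : ℝ => 1 - (1 + x ^ l)⁻¹) (Ioi 0) (Ioo 0 1) := by
  refine ⟨fun x hx => ?_, fun x hx y hy hxy => ?_, fun t ht => ?_⟩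
  · have hpow : 0 < x ^ l := Real.rpow_pos_of_pos hx l
    exact ⟨sub_pos.2 (inv_lt_one_of_one_lt₀ (by linarith)), sub_lt_self _ (by positivity)⟩
  · simp only [sub_right_inj, inv_inj, add_right_inj] at hxy
    exact (Real.rpow_left_inj (le_of_lt hx) (le_of_lt hy) hl.ne').1 hxy
  · have ht0 : 0 < t := ht.1
    have ht1 : 0 < 1 - t := sub_pos.2 ht.2
    refine ⟨(t / (1 - t)) ^ (1 / l), Real.rpow_pos_of_pos (div_pos ht0 ht1) _, ?_⟩
    dsimp only
    rw [← Real.rpow_mul (by positivity), one_div_mul_cancel hl.ne', Real.rpow_one]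
    field

lemma betaIntegrand_comp_mul_deriv (p : ℝ) (hl : 0 < l) {x : ℝ} (hx : 0 < x) :
    l * x ^ (l - 1) / (1 + x ^ l) ^ 2 * ((1 - (1 + x ^ l)⁻¹) ^ (1 / l - 1) *
      (1 - (1 - (1 + x ^ l)⁻¹)) ^ ((p * (1 + l) - 1) / l - 1)) = l * blissDensity p l x := by
  have hpos : (0 : ℝ) < 1 + x ^ l := by positivity
  have hfrac : 1 - (1 + x ^ l)⁻¹ = x ^ l * (1 + x ^ l)⁻¹ := by field
  have hxpow : (x ^ l) ^ (1 / l - 1) = (x ^ (l - 1))⁻¹ := by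
    rw [← Real.rpow_mul hx.le, ← Real.rpow_neg hx.le]; congr 1; field
  have hdensity : blissDensity p l x = (1 + x ^ l) ^ (-(1 / l - 1)) *
      (1 + x ^ l) ^ (-((p * (1 + l) - 1) / l - 1)) / (1 + x ^ l) ^ 2 := by
    rw [blissDensity, ← Real.rpow_natCast, ← Real.rpow_add hpos, ← Real.rpow_sub hpos]
    congr 1; push_cast; field
  have : 0 < x ^ (l - 1) := by positivity
  rw [sub_sub_cancel, hfrac, Real.mul_rpow (by positivity) (by positivity), hxpow, hdensity,
    Real.inv_rpow hpos.le, Real.inv_rpow hpos.le, ← Real.rpow_neg hpos.le, ← Real.rpow_neg hpos.le]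
  field

lemma integral_blissDensity_eq_betaFn (p : ℝ) (hl : 0 < l) :
    ∫ x in Ioi 0, blissDensity p l x = 1 / l * betaFn (1 / l) ((p * (1 + l) - 1) / l) := by
  have hbij := bijOn_one_sub_inv_one_add_rpow hl
  have hsubst := integral_image_eq_integral_abs_deriv_smul measurableSet_Ioi
    (fun x hx => (hasDerivAt_one_sub_inv_one_add_rpow (l := l) hx).hasDerivWithinAt) hbij.injOn
    (fun t => t ^ (1 / l - 1) * (1 - t) ^ ((p * (1 + l) - 1) / l - 1))
  rw [hbij.image_eq] at hsubst
  rw [betaFn, intervalIntegral.integral_of_le zero_le_one, integral_Ioc_eq_integral_Ioo, hsubst,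
    ← integral_const_mul]
  refine setIntegral_congr_fun measurableSet_Ioi fun x hx => ?_
  have hx0 : (0 : ℝ) < x := hx
  rw [smul_eq_mul, abs_of_nonneg (by positivity), betaIntegrand_comp_mul_deriv p hl hx0]
  field

lemma blissFactor_eq_of_ne (hp : 1 < p) (hl : 0 < l) :
    blissFactor p (p * (1 + l)) = (p.conjExponent / (p * (1 + l))) ^ (1 / (p * (1 + l))) *
      (∫ x in Ioi 0, blissDensity p l x) ^ (1 / (p * (1 + l)) - 1 / p) := by
  have : 0 < p := by linarith
  have hq1 : p * (1 + l) - 1 ≠ 0 := by nlinarith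
  have hsub : p * (1 + l) - p = p * l := by ring
  have hz : p / (p * (1 + l) - p) = 1 / l := by rw [hsub]; field
  have hw : p * (p * (1 + l)) / ((p * (1 + l)).conjExponent * (p * (1 + l) - p)) =
      (p * (1 + l) - 1) / l := by
    rw [hsub, Real.conjExponent]; field
  rw [blissFactor, if_neg (by nlinarith), hz, hw, ← integral_blissDensity_eq_betaFn p hl]

lemma blissFactor_pos (hp : 1 < p) (hpq : p ≤ q) : 0 < blissFactor p q := by
  have : 0 < p - 1 := by linarith
  rcases hpq.eq_or_lt with rfl | hlt
  · rw [blissFactor, if_pos rfl]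
    positivity
  · obtain ⟨l, rfl⟩ : ∃ l, q = p * (1 + l) := ⟨q / p - 1, by field⟩
    have hl : 0 < l := by nlinarith
    have hD := integral_blissDensity_pos hp hl
    rw [blissFactor_eq_of_ne hp hl, Real.conjExponent]
    positivity

lemma blissFactor_rpow (hp : 1 < p) (hl : 0 < l) :
    blissFactor p (p * (1 + l)) ^ (p * (1 + l)) = blissConst p l := by
  have : 0 < p := by linarith
  have hp1 : 0 < p - 1 := by linarith
  have hD := integral_blissDensity_pos hp hl
  have hD_eq : p.conjExponent / (p * (1 + l)) * ∫ x in Ioi 0, blissDensity p l x =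
      ∫ x in Ioi 0, x ^ l * blissDensity p l x := by
    rw [integral_blissDensity_eq hp hl, Real.conjExponent]; field
  have hconj : 0 < p.conjExponent := by unfold Real.conjExponent; positivity
  rw [blissFactor_eq_of_ne hp hl, blissConst, ← hD_eq,
    Real.mul_rpow (by positivity) (by positivity),
    ← Real.rpow_mul (by positivity), ← Real.rpow_mul hD.le, one_div_mul_cancel (by positivity),
    Real.rpow_one, mul_div_assoc,
    show (1 / (p * (1 + l)) - 1 / p) * (p * (1 + l)) = 1 - (1 + l) by field,
    Real.rpow_sub hD, Real.rpow_one]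

theorem lintegral_primitive_rpow_le (hp : 1 < p) (hpq : p ≤ q) {f : ℝ → ℝ≥0∞}
    (hf : Measurable f) :
    ∫⁻ x in Ioi 0, (∫⁻ t in Ioo 0 x, f t) ^ q * ENNReal.ofReal (x ^ (-1 - q * ((p - 1) / p))) ≤
      ENNReal.ofReal (blissFactor p q) ^ q * (∫⁻ x in Ioi 0, f x ^ p) ^ (q / p) := by
  have hp0 : 0 < p := by linarith
  have : 0 < p - 1 := by linarith
  rcases hpq.eq_or_lt with rfl | hlt
  · rw [ENNReal.ofReal_rpow_of_pos (blissFactor_pos hp hpq), blissFactor, if_pos rfl,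
      div_self hp0.ne']
    exact lintegral_primitive_rpow_le_of_forall_interval hp0.le hp0.le zero_le_one (by positivity)
      (fun ha hab hint hhp hh => by
        simpa only [Real.rpow_one] using hardy_interval hp ha hab hint hhp hh) hf
  · obtain ⟨l, rfl⟩ : ∃ l, q = p * (1 + l) := ⟨q / p - 1, by field⟩
    have hl : 0 < l := by nlinarith
    rw [ENNReal.ofReal_rpow_of_pos (blissFactor_pos hp hpq), blissFactor_rpow hp hl,
      mul_div_cancel_left₀ _ hp0.ne']
    exact lintegral_primitive_rpow_le_of_forall_interval hp0.le (by positivity) (by positivity)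
      (blissConst_pos hp hl).le
      (fun ha hab hint hhp hh => bliss_interval hp hl ha hab hint hhp hh) hf

end BlissFactor

section Extremal
variable {p q l c : ℝ}

/-- The extremal function of Bliss' inequality from `L^p` to `L^q`, where `l = q / p - 1`. -/
def blissExtremal (l t : ℝ) : ℝ := (1 + t ^ l) ^ (-((1 + l) / l))

lemma blissExtremal_pos {t : ℝ} (ht : 0 ≤ t) : 0 < blissExtremal l t := by
  unfold blissExtremal; positivity

lemma blissExtremal_rpow {t : ℝ} (ht : 0 ≤ t) : blissExtremal l t ^ p = blissDensity p l t := by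
  rw [blissExtremal, blissDensity, ← Real.rpow_mul (by positivity)]; congr 1; ring

lemma intervalIntegrable_blissExtremal {x : ℝ} (hl : 0 < l) (hx : 0 ≤ x) :
    IntervalIntegrable (blissExtremal l) volume 0 x := by
  refine ((continuousOn_one_add_rpow_rpow hl _).mono ?_).intervalIntegrable
  rw [uIcc_of_le hx]
  exact Icc_subset_Ici_self

lemma integral_blissExtremal {x : ℝ} (hl : 0 < l) (hx : 0 ≤ x) :
    ∫ t in (0 : ℝ)..x, blissExtremal l t = x * (1 + x ^ l) ^ (-(1 / l)) := by
  have hderiv : ∀ t ∈ Ioo 0 x, HasDerivAt (fun t => t * (1 + t ^ l) ^ (-(1 / l)))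
      (blissExtremal l t) t := by
    intro t ht
    have ht0 : 0 < t := ht.1
    refine ((hasDerivAt_id' t).mul (hasDerivAt_one_add_rpow_rpow _ ht0)).congr_deriv ?_
    rw [blissExtremal, show -((1 + l) / l) = -(1 / l) - 1 by field,
      Real.rpow_sub_one (by positivity : 1 + t ^ l ≠ 0), Real.rpow_sub_one ht0.ne']
    field
  have hcont : ContinuousOn (fun t : ℝ => t * (1 + t ^ l) ^ (-(1 / l))) (Icc 0 x) :=
    continuousOn_id.mul ((continuousOn_one_add_rpow_rpow hl _).mono Icc_subset_Ici_self)
  rw [intervalIntegral.integral_eq_sub_of_hasDerivAt_of_le hx hcont hderiv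
    (intervalIntegrable_blissExtremal hl hx), zero_mul, sub_zero]

lemma integral_blissExtremal_rpow_mul {x : ℝ} (hp : p ≠ 0) (hl : 0 < l) (hx : 0 < x) :
    (∫ t in (0 : ℝ)..x, blissExtremal l t) ^ (p * (1 + l)) *
      x ^ (-1 - p * (1 + l) * ((p - 1) / p)) = x ^ l * blissDensity p l x := by
  have hpos : (0 : ℝ) < 1 + x ^ l := by positivity
  rw [integral_blissExtremal hl hx.le, Real.mul_rpow hx.le (by positivity), blissDensity,
    ← Real.rpow_mul hpos.le, mul_right_comm, ← Real.rpow_add hx]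
  congr 2 <;> field

lemma lintegral_blissExtremal_rpow (hp : 1 < p) (hl : 0 < l) :
    ∫⁻ x in Ioi 0, ENNReal.ofReal (blissExtremal l |x|) ^ p =
      ENNReal.ofReal (∫ x in Ioi 0, blissDensity p l x) := by
  rw [ofReal_integral_eq_lintegral_ofReal (integrableOn_blissDensity hp hl)
    (ae_restrict_of_forall_mem measurableSet_Ioi fun x hx => (blissDensity_pos (le_of_lt hx)).le)]
  refine setLIntegral_congr_fun measurableSet_Ioi fun x hx => ?_
  have hx0 : (0 : ℝ) < x := hx
  rw [abs_of_pos hx0, ENNReal.ofReal_rpow_of_pos (blissExtremal_pos hx0.le),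
    blissExtremal_rpow hx0.le]

lemma lintegral_Ioo_blissExtremal {x : ℝ} (hl : 0 < l) (hx : 0 ≤ x) :
    ∫⁻ t in Ioo 0 x, ENNReal.ofReal (blissExtremal l |t|) =
      ENNReal.ofReal (∫ t in (0 : ℝ)..x, blissExtremal l t) := by
  rw [ofReal_intervalIntegral_eq_lintegral hx (intervalIntegrable_blissExtremal hl hx)
    fun t ht => (blissExtremal_pos ht.1.le).le, setLIntegral_congr Ioo_ae_eq_Ioc]
  refine setLIntegral_congr_fun measurableSet_Ioc fun t ht => ?_
  rw [abs_of_pos ht.1]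

lemma lintegral_primitive_blissExtremal (hp : 1 < p) (hl : 0 < l) :
    ∫⁻ x in Ioi 0, (∫⁻ t in Ioo 0 x, ENNReal.ofReal (blissExtremal l |t|)) ^ (p * (1 + l)) *
        ENNReal.ofReal (x ^ (-1 - p * (1 + l) * ((p - 1) / p))) =
      ENNReal.ofReal (∫ x in Ioi 0, x ^ l * blissDensity p l x) := by
  have hq : 0 < p * (1 + l) := by nlinarith
  rw [ofReal_integral_eq_lintegral_ofReal (integrableOn_rpow_mul_blissDensity hp hl hl.le le_rfl)
    (ae_restrict_of_forall_mem measurableSet_Ioi fun x hx =>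
      mul_nonneg (Real.rpow_nonneg (le_of_lt hx) l) (blissDensity_pos (le_of_lt hx)).le)]
  refine setLIntegral_congr_fun measurableSet_Ioi fun x hx => ?_
  have hx0 : (0 : ℝ) < x := hx
  have hprim : 0 ≤ ∫ t in (0 : ℝ)..x, blissExtremal l t :=
    intervalIntegral.integral_nonneg hx0.le fun t ht => (blissExtremal_pos ht.1).le
  rw [lintegral_Ioo_blissExtremal hl hx0.le, ENNReal.ofReal_rpow_of_nonneg hprim hq.le,
    ← ENNReal.ofReal_mul (by positivity), integral_blissExtremal_rpow_mul (by linarith) hl hx0]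

lemma blissFactor_rpow_mul_lintegral_blissExtremal (hp : 1 < p) (hl : 0 < l) :
    ENNReal.ofReal (blissFactor p (p * (1 + l))) ^ (p * (1 + l)) *
        (∫⁻ x in Ioi 0, ENNReal.ofReal (blissExtremal l |x|) ^ p) ^ (1 + l) =
      ∫⁻ x in Ioi 0, (∫⁻ t in Ioo 0 x, ENNReal.ofReal (blissExtremal l |t|)) ^ (p * (1 + l)) *
        ENNReal.ofReal (x ^ (-1 - p * (1 + l) * ((p - 1) / p))) := by
  have hD := integral_blissDensity_pos hp hl
  rw [lintegral_blissExtremal_rpow hp hl, lintegral_primitive_blissExtremal hp hl,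
    ENNReal.ofReal_rpow_of_pos (blissFactor_pos hp (by nlinarith)), blissFactor_rpow hp hl,
    ENNReal.ofReal_rpow_of_pos hD, ← ENNReal.ofReal_mul (blissConst_pos hp hl).le, blissConst,
    div_mul_cancel₀ _ (by positivity)]

lemma lintegral_Ioo_rpow {a x : ℝ} (ha : 0 < a) (hx : 0 ≤ x) :
    ∫⁻ t in Ioo 0 x, ENNReal.ofReal (t ^ (a - 1)) = ENNReal.ofReal (x ^ a / a) := by
  have hval := integral_rpow (a := 0) (b := x) (r := a - 1) (Or.inl (by linarith))
  rw [sub_add_cancel, Real.zero_rpow ha.ne', sub_zero] at hval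
  rw [← hval, setLIntegral_congr Ioo_ae_eq_Ioc, ofReal_intervalIntegral_eq_lintegral hx
    (intervalIntegral.intervalIntegrable_rpow' (by linarith))
    fun t ht => Real.rpow_nonneg ht.1.le _]

lemma lintegral_indicator_rpow {p s : ℝ} (hp : 0 < p) (hs : -1 < s * p) :
    ∫⁻ x in Ioi 0, ENNReal.ofReal ((Ioo 0 1).indicator (fun t => t ^ s) x) ^ p =
      ENNReal.ofReal (1 / (s * p + 1)) := by
  have hpow : ∀ x, ENNReal.ofReal ((Ioo 0 1).indicator (fun t => t ^ s) x) ^ p =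
      (Ioo 0 1).indicator (fun t => ENNReal.ofReal (t ^ (s * p + 1 - 1))) x := by
    intro x
    by_cases hx : x ∈ Ioo (0 : ℝ) 1
    · have hx0 : 0 < x := hx.1
      rw [indicator_of_mem hx, indicator_of_mem hx, ENNReal.ofReal_rpow_of_pos (by positivity),
        ← Real.rpow_mul hx0.le, add_sub_cancel_right]
    · rw [indicator_of_notMem hx, indicator_of_notMem hx, ENNReal.ofReal_zero,
        ENNReal.zero_rpow_of_pos hp]
  simp_rw [hpow]
  rw [lintegral_indicator measurableSet_Ioo, Measure.restrict_restrict measurableSet_Ioo,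
    inter_eq_left.2 Ioo_subset_Ioi_self, lintegral_Ioo_rpow (by linarith) zero_le_one,
    Real.one_rpow]

lemma lintegral_Ioo_indicator_rpow {a x : ℝ} (ha : 0 < a) (hx0 : 0 ≤ x) (hx1 : x ≤ 1) :
    ∫⁻ t in Ioo 0 x, ENNReal.ofReal ((Ioo 0 1).indicator (fun t => t ^ (a - 1)) t) =
      ENNReal.ofReal (x ^ a / a) := by
  rw [← lintegral_Ioo_rpow ha hx0]
  refine setLIntegral_congr_fun measurableSet_Ioo fun t ht => ?_
  rw [indicator_of_mem (show t ∈ Ioo (0 : ℝ) 1 from ⟨ht.1, ht.2.trans_le hx1⟩)]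

-- `t ^ (1 / c - 1)` on `(0, 1)` has primitive `c x ^ (1 / c)`, and its `p`-th power is integrable
-- at the origin exactly when `c < p / (p - 1)`.
lemma exists_le_lintegral_primitive_rpow_self (hp : 1 < p) (hc0 : 0 < c) (hc : c < p / (p - 1)) :
    ∃ f : ℝ → ℝ, Measurable f ∧ (∀ x, 0 ≤ f x) ∧
      ∫⁻ x in Ioi 0, ENNReal.ofReal (f x) ^ p ≠ 0 ∧ ∫⁻ x in Ioi 0, ENNReal.ofReal (f x) ^ p ≠ ⊤ ∧
      ENNReal.ofReal c ^ p * ∫⁻ x in Ioi 0, ENNReal.ofReal (f x) ^ p ≤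
        ∫⁻ x in Ioi 0, (∫⁻ t in Ioo 0 x, ENNReal.ofReal (f t)) ^ p *
          ENNReal.ofReal (x ^ (-1 - p * ((p - 1) / p))) := by
  have hp0 : 0 < p := by linarith
  have hp1 : 0 < p - 1 := by linarith
  set s := 1 / c - 1
  have hs : 0 < s * p + 1 := by
    rw [lt_div_iff₀ hp1] at hc
    have : s * p + 1 = (p - c * (p - 1)) / c := by simp only [s]; field
    rw [this]
    exact div_pos (by linarith) hc0
  have hnorm := lintegral_indicator_rpow hp0 (s := s) (by linarith)
  refine ⟨(Ioo 0 1).indicator fun t => t ^ s,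
    (measurable_id.pow_const _).indicator measurableSet_Ioo,
    fun x => indicator_nonneg (fun t ht => Real.rpow_nonneg ht.1.le _) x, ?_, ?_, ?_⟩
  · rw [hnorm]
    exact (ENNReal.ofReal_pos.2 (by positivity)).ne'
  · rw [hnorm]
    exact ENNReal.ofReal_ne_top
  rw [hnorm]
  calc ENNReal.ofReal c ^ p * ENNReal.ofReal (1 / (s * p + 1))
      = ∫⁻ x in Ioo 0 1, ENNReal.ofReal c ^ p * ENNReal.ofReal (x ^ (s * p + 1 - 1)) := by
        rw [lintegral_const_mul _ (by fun_prop), lintegral_Ioo_rpow hs zero_le_one, Real.one_rpow]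
    _ = ∫⁻ x in Ioo 0 1,
        (∫⁻ t in Ioo 0 x, ENNReal.ofReal ((Ioo 0 1).indicator (fun t => t ^ s) t)) ^ p *
          ENNReal.ofReal (x ^ (-1 - p * ((p - 1) / p))) := by
        refine setLIntegral_congr_fun measurableSet_Ioo fun x hx => ?_
        have hx0 : 0 < x := hx.1
        rw [lintegral_Ioo_indicator_rpow (by positivity) hx0.le hx.2.le,
          ENNReal.ofReal_rpow_of_pos hc0, ENNReal.ofReal_rpow_of_pos (by positivity),
          ← ENNReal.ofReal_mul (by positivity), ← ENNReal.ofReal_mul (by positivity),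
          div_div_eq_mul_div, div_one, Real.mul_rpow (by positivity) hc0.le, ← Real.rpow_mul hx0.le,
          mul_right_comm, ← Real.rpow_add hx0, mul_comm]
        congr 3
        simp only [s]
        field
    _ ≤ _ := lintegral_mono_set Ioo_subset_Ioi_self

theorem exists_le_lintegral_primitive_rpow (hp : 1 < p) (hpq : p ≤ q) (hc0 : 0 < c)
    (hc : c < blissFactor p q) :
    ∃ f : ℝ → ℝ, Measurable f ∧ (∀ x, 0 ≤ f x) ∧
      ∫⁻ x in Ioi 0, ENNReal.ofReal (f x) ^ p ≠ 0 ∧ ∫⁻ x in Ioi 0, ENNReal.ofReal (f x) ^ p ≠ ⊤ ∧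
      ENNReal.ofReal c ^ q * (∫⁻ x in Ioi 0, ENNReal.ofReal (f x) ^ p) ^ (q / p) ≤
        ∫⁻ x in Ioi 0, (∫⁻ t in Ioo 0 x, ENNReal.ofReal (f t)) ^ q *
          ENNReal.ofReal (x ^ (-1 - q * ((p - 1) / p))) := by
  have hp0 : 0 < p := by linarith
  rcases hpq.eq_or_lt with rfl | hlt
  · rw [blissFactor, if_pos rfl] at hc
    simpa only [div_self hp0.ne', ENNReal.rpow_one] using
      exists_le_lintegral_primitive_rpow_self hp hc0 hc
  obtain ⟨l, rfl⟩ : ∃ l, q = p * (1 + l) := ⟨q / p - 1, by field⟩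
  have hl : 0 < l := by nlinarith
  have hnorm := lintegral_blissExtremal_rpow hp hl
  refine ⟨fun x => blissExtremal l |x|, by unfold blissExtremal; fun_prop,
    fun x => (blissExtremal_pos (abs_nonneg x)).le, ?_, ?_, ?_⟩
  · rw [hnorm]
    exact (ENNReal.ofReal_pos.2 (integral_blissDensity_pos hp hl)).ne'
  · rw [hnorm]
    exact ENNReal.ofReal_ne_top
  · rw [← blissFactor_rpow_mul_lintegral_blissExtremal hp hl, mul_div_cancel_left₀ _ hp0.ne']
    gcongr

end Extremal

section Minkowski
variable {X Y : Type*} [MeasurableSpace X] [MeasurableSpace Y] {μ : Measure X} {ν : Measure Y}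
  [SFinite ν] {s : ℝ} {G : X → Y → ℝ≥0∞}

lemma lintegral_rpow_le_of_le_lintegral [SFinite μ] (hs : 1 < s)
    (hG : Measurable (Function.uncurry G)) {φ : X → ℝ≥0∞} (hφ : Measurable φ)
    (hφG : ∀ x, φ x ≤ ∫⁻ y, G x y ∂ν) (hfin : ∫⁻ x, φ x ^ s ∂μ ≠ ⊤) :
    (∫⁻ x, φ x ^ s ∂μ) ^ (1 / s) ≤ ∫⁻ y, (∫⁻ x, G x y ^ s ∂μ) ^ (1 / s) ∂ν := by
  have hs1 : 0 < s - 1 := by linarith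
  have hconj : s.HolderConjugate (s / (s - 1)) := Real.HolderConjugate.conjExponent hs
  set A := ∫⁻ x, φ x ^ s ∂μ
  rcases eq_or_ne A 0 with hA | hA
  · rw [hA, ENNReal.zero_rpow_of_pos (by positivity)]
    exact zero_le
  have hholder : ∀ y, ∫⁻ x, φ x ^ (s - 1) * G x y ∂μ ≤
      A ^ (1 - 1 / s) * (∫⁻ x, G x y ^ s ∂μ) ^ (1 / s) := fun y => by
    refine (ENNReal.lintegral_mul_le_Lp_mul_Lq μ hconj.symm (hφ.pow_const _).aemeasurable
      hG.of_uncurry_right.aemeasurable).trans_eq ?_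
    simp_rw [← ENNReal.rpow_mul]
    rw [show (s - 1) * (s / (s - 1)) = s by field, show 1 / (s / (s - 1)) = 1 - 1 / s by field]
  have hself : A ^ (1 - 1 / s) * A ^ (1 / s) ≤
      A ^ (1 - 1 / s) * ∫⁻ y, (∫⁻ x, G x y ^ s ∂μ) ^ (1 / s) ∂ν :=
    calc A ^ (1 - 1 / s) * A ^ (1 / s) = ∫⁻ x, φ x ^ s ∂μ := by
          rw [← ENNReal.rpow_add _ _ hA hfin, sub_add_cancel, ENNReal.rpow_one]
      _ = ∫⁻ x, φ x ^ (s - 1) * φ x ∂μ := lintegral_congr fun x => by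
          nth_rw 3 [← ENNReal.rpow_one (φ x)]
          rw [← ENNReal.rpow_add_of_nonneg _ _ hs1.le zero_le_one, sub_add_cancel]
      _ ≤ ∫⁻ x, ∫⁻ y, φ x ^ (s - 1) * G x y ∂ν ∂μ := lintegral_mono fun x => by
          rw [lintegral_const_mul _ hG.of_uncurry_left]
          exact mul_le_mul' le_rfl (hφG x)
      _ = ∫⁻ y, ∫⁻ x, φ x ^ (s - 1) * G x y ∂μ ∂ν :=
          lintegral_lintegral_swap
            (((hφ.comp measurable_fst).pow_const _).mul hG).aemeasurable
      _ ≤ ∫⁻ y, A ^ (1 - 1 / s) * (∫⁻ x, G x y ^ s ∂μ) ^ (1 / s) ∂ν := lintegral_mono hholder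
      _ = _ := lintegral_const_mul' _ _ (ENNReal.rpow_ne_top_of_ne_zero hA hfin)
  exact (ENNReal.mul_le_mul_iff_right (by simp [hA, hfin])
    (ENNReal.rpow_ne_top_of_ne_zero hA hfin)).1 hself

theorem lintegral_lintegral_rpow_le [SigmaFinite μ] (hs : 1 ≤ s)
    (hG : Measurable (Function.uncurry G)) :
    (∫⁻ x, (∫⁻ y, G x y ∂ν) ^ s ∂μ) ^ (1 / s) ≤ ∫⁻ y, (∫⁻ x, G x y ^ s ∂μ) ^ (1 / s) ∂ν := by
  rcases hs.eq_or_lt with rfl | hs1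
  · simp only [ENNReal.rpow_one, div_one]
    exact (lintegral_lintegral_swap hG.aemeasurable).le
  have hs0 : 0 < s := by linarith
  rw [one_div, ENNReal.rpow_inv_le_iff hs0]
  refine le_of_forall_lt fun L hL => ?_
  rw [lintegral_eq_nnreal] at hL
  obtain ⟨ψ₀, hψ₀⟩ := lt_iSup_iff.1 hL
  obtain ⟨hψ₀le, hL⟩ := lt_iSup_iff.1 hψ₀
  rw [← SimpleFunc.lintegral_eq_lintegral] at hL
  obtain ⟨ψ, hψ, hψfin, hLψ⟩ := SimpleFunc.exists_lt_lintegral_simpleFunc_of_lt_lintegral hL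
  have hpow : ∀ x, ((ψ x : ℝ≥0∞) ^ (1 / s)) ^ s = ψ x := fun x => by
    rw [← ENNReal.rpow_mul, one_div_mul_cancel hs0.ne', ENNReal.rpow_one]
  have hψG : ∀ x, (ψ x : ℝ≥0∞) ^ (1 / s) ≤ ∫⁻ y, G x y ∂ν := fun x => by
    rw [one_div, ENNReal.rpow_inv_le_iff hs0]
    exact (ENNReal.coe_le_coe.2 (hψ x)).trans (hψ₀le x)
  have key := lintegral_rpow_le_of_le_lintegral hs1 hG
    (ψ.measurable.coe_nnreal_ennreal.pow_const (1 / s)) hψG (by simpa only [hpow] using hψfin.ne)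
  simp only [hpow] at key
  rw [one_div, ENNReal.rpow_inv_le_iff hs0] at key
  simpa only [one_div] using hLψ.trans_le key

end Minkowski

section KernelBound

variable {X Y X' Y' : Type*} [MeasurableSpace X] [MeasurableSpace Y] [MeasurableSpace X']
  [MeasurableSpace Y'] {p q : ℝ}

/-- The positive integral operator with kernel `k` maps `L^p (b ν)` to `L^q μ`, with `C` bounding
the `q`-th power of its norm. Extended nonnegative functions make every integral meaningful. -/
def KernelBound (p q : ℝ) (μ : Measure X) (ν : Measure Y) (k : X → Y → ℝ≥0∞) (b : Y → ℝ≥0∞)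
    (C : ℝ≥0∞) : Prop :=
  ∀ ⦃f : Y → ℝ≥0∞⦄, Measurable f →
    ∫⁻ x, (∫⁻ y, k x y * f y ∂ν) ^ q ∂μ ≤ C * (∫⁻ y, f y ^ p * b y ∂ν) ^ (q / p)

lemma KernelBound.of_comp_measurePreserving {μ : Measure X} {ν : Measure Y} {μ' : Measure X'}
    {ν' : Measure Y'} {k : X' → Y' → ℝ≥0∞} {b : Y' → ℝ≥0∞} {C : ℝ≥0∞} {e : X ≃ᵐ X'} {e' : Y ≃ᵐ Y'}
    (he : MeasurePreserving e μ μ') (he' : MeasurePreserving e' ν ν')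
    (h : KernelBound p q μ ν (fun x y => k (e x) (e' y)) (fun y => b (e' y)) C) :
    KernelBound p q μ' ν' k b C := fun f hf => by
  simp only [← he'.lintegral_comp_emb e'.measurableEmbedding]
  rw [← he.lintegral_comp_emb e.measurableEmbedding]
  exact h (hf.comp e'.measurable)

lemma lintegral_lintegral_rpow_mul_le {μ : Measure X} {ν : Measure Y} [SigmaFinite μ] [SFinite ν]
    (hp : 0 < p) (hpq : p ≤ q) {g : X → Y → ℝ≥0∞} (hg : Measurable (Function.uncurry g))
    {b : Y → ℝ≥0∞} (hb : Measurable b) :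
    ∫⁻ x, (∫⁻ y, g x y ^ p * b y ∂ν) ^ (q / p) ∂μ ≤
      (∫⁻ y, (∫⁻ x, g x y ^ q ∂μ) ^ (p / q) * b y ∂ν) ^ (q / p) := by
  have hq : 0 < q := hp.trans_le hpq
  have hr : 0 < q / p := by positivity
  have hinner : ∀ y, (∫⁻ x, (g x y ^ p * b y) ^ (q / p) ∂μ) ^ (p / q) =
      (∫⁻ x, g x y ^ q ∂μ) ^ (p / q) * b y := fun y => by
    simp_rw [ENNReal.mul_rpow_of_nonneg _ _ hr.le, ← ENNReal.rpow_mul, mul_div_cancel₀ _ hp.ne']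
    rw [lintegral_mul_const _ (hg.of_uncurry_right.pow_const _),
      ENNReal.mul_rpow_of_nonneg _ _ (by positivity), ← ENNReal.rpow_mul,
      show q / p * (p / q) = 1 by field, ENNReal.rpow_one]
  rw [← ENNReal.rpow_inv_le_iff hr, ← one_div]
  simpa only [one_div_div, hinner] using
    lintegral_lintegral_rpow_le (μ := μ) (ν := ν) ((one_le_div hp).2 hpq)
      (G := fun x y => g x y ^ p * b y) ((hg.pow_const p).mul (hb.comp measurable_snd))

variable {X₁ X₂ Y₁ Y₂ : Type*} [MeasurableSpace X₁] [MeasurableSpace X₂] [MeasurableSpace Y₁]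
  [MeasurableSpace Y₂] {μ₁ : Measure X₁} {μ₂ : Measure X₂} {ν₁ : Measure Y₁} {ν₂ : Measure Y₂}
  [SigmaFinite μ₁] [SFinite ν₁] [SFinite ν₂] {k₁ : X₁ → Y₁ → ℝ≥0∞} {k₂ : X₂ → Y₂ → ℝ≥0∞}
  {b₁ : Y₁ → ℝ≥0∞} {b₂ : Y₂ → ℝ≥0∞} {C₁ C₂ : ℝ≥0∞}

lemma measurable_lintegral_mul (hk : Measurable (Function.uncurry k₁)) {f : Y₁ × Y₂ → ℝ≥0∞}
    (hf : Measurable f) :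
    Measurable (Function.uncurry fun x y₂ => ∫⁻ y₁, k₁ x y₁ * f (y₁, y₂) ∂ν₁) :=
  Measurable.lintegral_prod_right' (f := fun z : (X₁ × Y₂) × Y₁ => k₁ z.1.1 z.2 * f (z.2, z.1.2))
    ((hk.comp (f := fun z : (X₁ × Y₂) × Y₁ => (z.1.1, z.2)) (by fun_prop)).mul (by fun_prop))

lemma KernelBound.lintegral_lintegral_le (hp : 0 < p) (hpq : p ≤ q)
    (h : KernelBound p q μ₁ ν₁ k₁ b₁ C₁) (hk : Measurable (Function.uncurry k₁))
    (hb₁ : Measurable b₁) (hb₂ : Measurable b₂) {f : Y₁ × Y₂ → ℝ≥0∞} (hf : Measurable f) :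
    ∫⁻ x, (∫⁻ y₂, (∫⁻ y₁, k₁ x y₁ * f (y₁, y₂) ∂ν₁) ^ p * b₂ y₂ ∂ν₂) ^ (q / p) ∂μ₁ ≤
      C₁ * (∫⁻ y, f y ^ p * (b₁ y.1 * b₂ y.2) ∂ν₁.prod ν₂) ^ (q / p) := by
  have hq : 0 < q := hp.trans_le hpq
  have hr : p / q * (q / p) = 1 := by field
  have hfslice : ∀ y₂, Measurable fun y₁ => f (y₁, y₂) := fun y₂ => hf.comp measurable_prodMk_right
  have hslice : ∀ y₂, (∫⁻ x, (∫⁻ y₁, k₁ x y₁ * f (y₁, y₂) ∂ν₁) ^ q ∂μ₁) ^ (p / q) ≤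
      C₁ ^ (p / q) * ∫⁻ y₁, f (y₁, y₂) ^ p * b₁ y₁ ∂ν₁ := fun y₂ => by
    have := ENNReal.rpow_le_rpow (h (hfslice y₂)) (z := p / q) (by positivity)
    rwa [ENNReal.mul_rpow_of_nonneg _ _ (by positivity), ← ENNReal.rpow_mul (∫⁻ y, _ ∂ν₁),
      mul_comm (q / p), hr, ENNReal.rpow_one] at this
  have hm : Measurable fun y : Y₁ × Y₂ => f y ^ p * (b₁ y.1 * b₂ y.2) := by fun_prop
  calc _ ≤ (∫⁻ y₂, (∫⁻ x, (∫⁻ y₁, k₁ x y₁ * f (y₁, y₂) ∂ν₁) ^ q ∂μ₁) ^ (p / q) * b₂ y₂ ∂ν₂) ^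
          (q / p) :=
          lintegral_lintegral_rpow_mul_le hp hpq (measurable_lintegral_mul hk hf) hb₂
    _ ≤ (∫⁻ y₂, C₁ ^ (p / q) * ∫⁻ y₁, f (y₁, y₂) ^ p * (b₁ y₁ * b₂ y₂) ∂ν₁ ∂ν₂) ^ (q / p) := by
        refine ENNReal.rpow_le_rpow (lintegral_mono fun y₂ => ?_) (by positivity)
        simp only [← mul_assoc (f _ ^ p)]
        rw [lintegral_mul_const _ (f := fun y₁ => f (y₁, y₂) ^ p * b₁ y₁)
          (((hfslice y₂).pow_const p).mul hb₁), ← mul_assoc]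
        gcongr
        exact hslice y₂
    _ = _ := by
        rw [lintegral_const_mul _ hm.lintegral_prod_left',
          ENNReal.mul_rpow_of_nonneg _ _ (by positivity), ← ENNReal.rpow_mul, hr, ENNReal.rpow_one,
          lintegral_prod_symm _ hm.aemeasurable]

theorem KernelBound.prod [SFinite μ₂] (hp : 0 < p) (hpq : p ≤ q)
    (h₁ : KernelBound p q μ₁ ν₁ k₁ b₁ C₁) (h₂ : KernelBound p q μ₂ ν₂ k₂ b₂ C₂)
    (hk₁ : Measurable (Function.uncurry k₁)) (hk₂ : Measurable (Function.uncurry k₂))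
    (hb₁ : Measurable b₁) (hb₂ : Measurable b₂) :
    KernelBound p q (μ₁.prod μ₂) (ν₁.prod ν₂) (fun x y => k₁ x.1 y.1 * k₂ x.2 y.2)
      (fun y => b₁ y.1 * b₂ y.2) (C₁ * C₂) := fun f hf => by
  have hg := measurable_lintegral_mul (ν₁ := ν₁) hk₁ hf
  have hiter : ∀ x : X₁ × X₂, ∫⁻ y, k₁ x.1 y.1 * k₂ x.2 y.2 * f y ∂ν₁.prod ν₂ =
      ∫⁻ y₂, k₂ x.2 y₂ * ∫⁻ y₁, k₁ x.1 y₁ * f (y₁, y₂) ∂ν₁ ∂ν₂ := fun x => by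
    have hk₁x : Measurable (k₁ x.1) := hk₁.of_uncurry_left
    have hk₂x : Measurable (k₂ x.2) := hk₂.of_uncurry_left
    rw [lintegral_prod_symm _ (by fun_prop)]
    refine lintegral_congr fun y₂ => ?_
    rw [← lintegral_const_mul _ (by fun_prop)]
    exact lintegral_congr fun y₁ => by ring
  simp only [hiter]
  calc _ ≤ ∫⁻ x₁, ∫⁻ x₂, (∫⁻ y₂, k₂ x₂ y₂ * ∫⁻ y₁, k₁ x₁ y₁ * f (y₁, y₂) ∂ν₁ ∂ν₂) ^ q ∂μ₂ ∂μ₁ :=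
        lintegral_prod_le _
    _ ≤ ∫⁻ x₁, C₂ * (∫⁻ y₂, (∫⁻ y₁, k₁ x₁ y₁ * f (y₁, y₂) ∂ν₁) ^ p * b₂ y₂ ∂ν₂) ^ (q / p) ∂μ₁ :=
        lintegral_mono fun x₁ => h₂ hg.of_uncurry_left
    _ = C₂ * ∫⁻ x₁, (∫⁻ y₂, (∫⁻ y₁, k₁ x₁ y₁ * f (y₁, y₂) ∂ν₁) ^ p * b₂ y₂ ∂ν₂) ^ (q / p) ∂μ₁ :=
        lintegral_const_mul _ (Measurable.pow_const (Measurable.lintegral_prod_right'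
          ((hg.pow_const p).mul (hb₂.comp measurable_snd))) _)
    _ ≤ C₂ * (C₁ * (∫⁻ y, f y ^ p * (b₁ y.1 * b₂ y.2) ∂ν₁.prod ν₂) ^ (q / p)) := by
        gcongr
        exact h₁.lintegral_lintegral_le hp hpq hk₁ hb₁ hb₂ hf
    _ = _ := by ring

theorem KernelBound.pi (hp : 0 < p) (hpq : p ≤ q) {m : ℕ} {X Y : Fin m → Type*}
    [∀ i, MeasurableSpace (X i)] [∀ i, MeasurableSpace (Y i)] {μ : ∀ i, Measure (X i)}
    {ν : ∀ i, Measure (Y i)} [∀ i, SigmaFinite (μ i)] [∀ i, SigmaFinite (ν i)]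
    {k : ∀ i, X i → Y i → ℝ≥0∞} {b : ∀ i, Y i → ℝ≥0∞} {C : Fin m → ℝ≥0∞}
    (h : ∀ i, KernelBound p q (μ i) (ν i) (k i) (b i) (C i))
    (hk : ∀ i, Measurable (Function.uncurry (k i))) (hb : ∀ i, Measurable (b i)) :
    KernelBound p q (Measure.pi μ) (Measure.pi ν) (fun x y => ∏ i, k i (x i) (y i))
      (fun y => ∏ i, b i (y i)) (∏ i, C i) := by
  induction m with
  | zero =>
    intro f _
    rw [Measure.pi_of_empty μ, Measure.pi_of_empty ν]
    simp only [lintegral_dirac, Finset.univ_eq_empty, Finset.prod_empty, one_mul, mul_one,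
      ← ENNReal.rpow_mul, mul_div_cancel₀ _ hp.ne', le_refl]
  | succ m ih =>
    refine .of_comp_measurePreserving (measurePreserving_piFinSuccAbove μ 0).symm
      (measurePreserving_piFinSuccAbove ν 0).symm ?_
    have htail := ih (fun j => h j.succ) (fun j => hk j.succ) (fun j => hb j.succ)
    have := (h 0).prod hp hpq htail (hk 0)
      (Finset.univ.measurable_fun_prod fun j _ => (hk j.succ).comp
        (f := fun z : (∀ j : Fin m, X j.succ) × (∀ j : Fin m, Y j.succ) => (z.1 j, z.2 j))
        (by fun_prop)) (hb 0) (by fun_prop)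
    simp only [Fin.prod_univ_succ]
    exact this

end KernelBound

lemma lintegral_pi_prod {m : ℕ} {X : Fin m → Type*} [∀ i, MeasurableSpace (X i)]
    {μ : ∀ i, Measure (X i)} [∀ i, SigmaFinite (μ i)] {f : ∀ i, X i → ℝ≥0∞}
    (hf : ∀ i, Measurable (f i)) :
    ∫⁻ x, ∏ i, f i (x i) ∂Measure.pi μ = ∏ i, ∫⁻ x, f i x ∂μ i := by
  induction m with
  | zero => simp [Measure.pi_of_empty μ]
  | succ m ih =>
    have e := (measurePreserving_piFinSuccAbove μ 0).symm
    have htail : Measurable fun x : ∀ j : Fin m, X j.succ => ∏ j, f j.succ (x j) :=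
      Finset.univ.measurable_fun_prod fun j _ => (hf j.succ).comp (measurable_pi_apply j)
    rw [← e.lintegral_comp (by fun_prop), Fin.prod_univ_succ, ← ih fun j => hf j.succ,
      ← lintegral_prod_mul (hf 0).aemeasurable htail.aemeasurable]
    simp only [Fin.prod_univ_succ]
    rfl

section Polar

lemma lintegral_comp_rpow_Ioi {a : ℝ} (ha : 0 < a) (g : ℝ → ℝ≥0∞) :
    ∫⁻ u in Ioi 0, ENNReal.ofReal (a * u ^ (a - 1)) * g (u ^ a) = ∫⁻ r in Ioi 0, g r := by
  have himg : (fun u : ℝ => u ^ a) '' Ioi 0 = Ioi 0 := by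
    refine Subset.antisymm (image_subset_iff.2 fun u hu => Real.rpow_pos_of_pos hu a) fun r hr => ?_
    exact ⟨r ^ a⁻¹, Real.rpow_pos_of_pos hr _, Real.rpow_inv_rpow (le_of_lt hr) ha.ne'⟩
  have hinj : InjOn (fun u : ℝ => u ^ a) (Ioi 0) := fun x hx y hy =>
    (Real.rpow_left_inj (le_of_lt hx) (le_of_lt hy) ha.ne').1
  have hderiv : ∀ u ∈ Ioi (0 : ℝ),
      HasDerivWithinAt (fun u : ℝ => u ^ a) (a * u ^ (a - 1)) (Ioi 0) u := fun u hu =>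
    (Real.hasDerivAt_rpow_const (Or.inl (ne_of_gt hu))).hasDerivWithinAt
  have hsubst := lintegral_image_eq_lintegral_abs_deriv_mul measurableSet_Ioi hderiv hinj g
  rw [himg] at hsubst
  rw [hsubst]
  refine setLIntegral_congr_fun measurableSet_Ioi fun u (hu : 0 < u) => ?_
  rw [abs_of_pos (by positivity)]

variable {E : Type*} [NormedAddCommGroup E] [NormedSpace ℝ E]

lemma norm_rpow_smul_sphere (c : ℝ) {u : ℝ} (hu : 0 ≤ u) (θ : Metric.sphere (0 : E) 1) :
    ‖u ^ c • (θ : E)‖ = u ^ c := by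
  rw [norm_smul, norm_eq_of_mem_sphere, mul_one, Real.norm_of_nonneg (by positivity)]

variable [MeasurableSpace E]

/-- The density of the integral of `f` over balls with respect to `μ`, in the variable
`u = ‖x‖ ^ c`. -/
def radialDensity (μ : Measure E) (c : ℝ) (f : E → ℝ≥0∞) (u : ℝ) : ℝ≥0∞ :=
  ENNReal.ofReal (1 / c * u ^ (Module.finrank ℝ E / c - 1)) *
    ∫⁻ θ, f (u ^ (1 / c) • (θ : E)) ∂μ.toSphere

lemma radialDensity_norm (μ : Measure E) {c u : ℝ} (hu : 0 ≤ u) (φ : ℝ → ℝ≥0∞) :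
    radialDensity μ c (fun x => φ ‖x‖) u =
      ENNReal.ofReal (1 / c * u ^ (Module.finrank ℝ E / c - 1)) *
        (φ (u ^ (1 / c)) * μ.toSphere univ) := by
  simp only [radialDensity, norm_rpow_smul_sphere _ hu, lintegral_const]

variable [BorelSpace E] [FiniteDimensional ℝ E] (μ : Measure E) [μ.IsAddHaarMeasure]

@[fun_prop]
lemma measurable_radialDensity (c : ℝ) {f : E → ℝ≥0∞} (hf : Measurable f) :
    Measurable (radialDensity μ c f) :=
  Measurable.mul (by fun_prop) (Measurable.lintegral_prod_right'
    (f := fun z : ℝ × Metric.sphere (0 : E) 1 => f (z.1 ^ (1 / c) • z.2.1)) (by fun_prop))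

variable [Nontrivial E]

lemma lintegral_polar {f : E → ℝ≥0∞} (hf : Measurable f) :
    ∫⁻ x, f x ∂μ = ∫⁻ r in Ioi (0 : ℝ), ENNReal.ofReal (r ^ ((Module.finrank ℝ E : ℝ) - 1)) *
      ∫⁻ θ, f (r • (θ : E)) ∂μ.toSphere := by
  have hfg : Measurable fun z : Metric.sphere (0 : E) 1 × Ioi (0 : ℝ) => f (z.2.1 • z.1.1) := by
    fun_prop
  have hpow : ∀ r : Ioi (0 : ℝ),
      r.1 ^ (Module.finrank ℝ E - 1) = r.1 ^ ((Module.finrank ℝ E : ℝ) - 1) := fun r => by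
    rw [← Real.rpow_natCast, Nat.cast_sub Module.finrank_pos, Nat.cast_one]
  have hpolar : ∀ x : ({0}ᶜ : Set E),
      (homeomorphUnitSphereProd E x).2.1 • (homeomorphUnitSphereProd E x).1.1 = x.1 := fun x =>
    congrArg Subtype.val ((homeomorphUnitSphereProd E).symm_apply_apply x)
  calc ∫⁻ x, f x ∂μ = ∫⁻ x : ({0}ᶜ : Set E), f x.1 ∂μ.comap Subtype.val := by
        rw [lintegral_subtype_comap (measurableSet_singleton _).compl, restrict_compl_singleton]
    _ = ∫⁻ z, f (z.2.1 • z.1.1)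
          ∂μ.toSphere.prod (Measure.volumeIoiPow (Module.finrank ℝ E - 1)) := by
        rw [← μ.measurePreserving_homeomorphUnitSphereProd.lintegral_comp hfg]
        simp only [hpolar]
    _ = ∫⁻ r, ∫⁻ θ, f (r.1 • θ.1) ∂μ.toSphere
          ∂Measure.volumeIoiPow (Module.finrank ℝ E - 1) := lintegral_prod_symm' _ hfg
    _ = ∫⁻ r : Ioi (0 : ℝ), ENNReal.ofReal (r.1 ^ ((Module.finrank ℝ E : ℝ) - 1)) *
          ∫⁻ θ, f (r.1 • θ.1) ∂μ.toSphere ∂Measure.comap Subtype.val volume := by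
        rw [Measure.volumeIoiPow, lintegral_withDensity_eq_lintegral_mul _ (by fun_prop)
          hfg.lintegral_prod_left']
        simp only [Pi.mul_apply, hpow]
    _ = _ := lintegral_subtype_comap measurableSet_Ioi fun r : ℝ =>
        ENNReal.ofReal (r ^ ((Module.finrank ℝ E : ℝ) - 1)) * ∫⁻ θ, f (r • θ.1) ∂μ.toSphere

lemma lintegral_eq_lintegral_radialDensity {c : ℝ} (hc : 0 < c) {f : E → ℝ≥0∞}
    (hf : Measurable f) : ∫⁻ x, f x ∂μ = ∫⁻ u in Ioi (0 : ℝ), radialDensity μ c f u := by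
  rw [lintegral_polar μ hf, ← lintegral_comp_rpow_Ioi (one_div_pos.2 hc)]
  refine setLIntegral_congr_fun measurableSet_Ioi fun u (hu : 0 < u) => ?_
  rw [radialDensity, ← mul_assoc, ← ENNReal.ofReal_mul (by positivity), ← Real.rpow_mul hu.le,
    mul_assoc, ← Real.rpow_add hu]
  congr 4
  field

lemma lintegral_ball_eq_lintegral_radialDensity {c r : ℝ} (hc : 0 < c) (hr : 0 ≤ r)
    {f : E → ℝ≥0∞} (hf : Measurable f) :
    ∫⁻ x in Metric.ball 0 r, f x ∂μ = ∫⁻ u in Ioo 0 (r ^ c), radialDensity μ c f u := by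
  have hball : MeasurableSet (Metric.ball (0 : E) r) := measurableSet_ball
  rw [← lintegral_indicator hball, lintegral_eq_lintegral_radialDensity μ hc (hf.indicator hball),
    ← Ioi_inter_Iio, inter_comm, ← setLIntegral_indicator measurableSet_Iio]
  refine setLIntegral_congr_fun measurableSet_Ioi fun u (hu : 0 < u) => ?_
  have hmem : ∀ θ : Metric.sphere (0 : E) 1,
      u ^ (1 / c) • (θ : E) ∈ Metric.ball 0 r ↔ u ∈ Iio (r ^ c) := fun θ => by
    rw [mem_ball_zero_iff, norm_rpow_smul_sphere _ hu.le, one_div, mem_Iio,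
      Real.rpow_inv_lt_iff_of_pos hu.le hr hc]
  by_cases hur : u ∈ Iio (r ^ c) <;>
    simp only [radialDensity, indicator, hmem, hur, if_true, if_false, lintegral_zero, mul_zero]

variable {p c γ : ℝ}

lemma lintegral_rpow_mul_norm_rpow (hc : 0 < c)
    (hcγ : c * (p - 1) = Module.finrank ℝ E * (p - 1) - γ) {f : E → ℝ≥0∞} (hf : Measurable f) :
    ENNReal.ofReal (c ^ (1 - p)) * ∫⁻ x, f x ^ p * ENNReal.ofReal (‖x‖ ^ γ) ∂μ =
      ∫⁻ u in Ioi (0 : ℝ), ENNReal.ofReal (1 / c * u ^ (Module.finrank ℝ E / c - 1)) ^ p *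
        ∫⁻ θ, f (u ^ (1 / c) • (θ : E)) ^ p ∂μ.toSphere := by
  rw [lintegral_eq_lintegral_radialDensity μ hc (by fun_prop),
    ← lintegral_const_mul' _ _ ENNReal.ofReal_ne_top]
  refine setLIntegral_congr_fun measurableSet_Ioi fun u (hu : 0 < u) => ?_
  have hexp : u ^ ((Module.finrank ℝ E / c - 1) * p) =
      u ^ (Module.finrank ℝ E / c - 1) * u ^ (1 / c * γ) := by
    rw [← Real.rpow_add hu]
    congr 1
    field_simp
    linarith
  simp only [radialDensity, norm_rpow_smul_sphere _ hu.le]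
  rw [lintegral_mul_const' _ _ ENNReal.ofReal_ne_top, mul_comm (∫⁻ θ, _ ∂_), ← mul_assoc,
    ← mul_assoc, ENNReal.ofReal_rpow_of_pos (by positivity), ← ENNReal.ofReal_mul (by positivity),
    ← ENNReal.ofReal_mul (by positivity), Real.mul_rpow (by positivity) (by positivity),
    ← Real.rpow_mul hu.le, ← Real.rpow_mul hu.le, hexp, one_div, Real.inv_rpow hc.le,
    Real.rpow_sub hc, Real.rpow_one]
  congr 2
  field

lemma lintegral_radialDensity_rpow_le (hc : 0 < c) (hp : 1 < p)
    (hcγ : c * (p - 1) = Module.finrank ℝ E * (p - 1) - γ) {f : E → ℝ≥0∞} (hf : Measurable f) :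
    ∫⁻ u in Ioi (0 : ℝ), radialDensity μ c f u ^ p ≤
      ENNReal.ofReal (c ^ (1 - p)) * μ.toSphere univ ^ (p - 1) *
        ∫⁻ x, f x ^ p * ENNReal.ofReal (‖x‖ ^ γ) ∂μ := by
  have hp0 : 0 < p := by linarith
  have hp1 : p - 1 ≠ 0 := by linarith
  have hholder : ∀ u : ℝ, (∫⁻ θ, f (u ^ (1 / c) • (θ : E)) ∂μ.toSphere) ^ p ≤
      μ.toSphere univ ^ (p - 1) * ∫⁻ θ, f (u ^ (1 / c) • (θ : E)) ^ p ∂μ.toSphere := fun u => by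
    have hm : Measurable fun θ : Metric.sphere (0 : E) 1 => f (u ^ (1 / c) • θ.1) := by fun_prop
    have := ENNReal.rpow_le_rpow (ENNReal.lintegral_mul_le_Lp_mul_Lq μ.toSphere
      (Real.HolderConjugate.conjExponent hp) hm.aemeasurable
      (aemeasurable_const (b := (1 : ℝ≥0∞)))) hp0.le
    simp only [Pi.mul_apply, mul_one, ENNReal.one_rpow, lintegral_one] at this
    refine this.trans_eq ?_
    rw [ENNReal.mul_rpow_of_nonneg _ _ hp0.le, ← ENNReal.rpow_mul, ← ENNReal.rpow_mul,
      one_div_mul_cancel hp0.ne', ENNReal.rpow_one, mul_comm, Real.conjExponent,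
      show 1 / (p / (p - 1)) * p = p - 1 by field]
  rw [mul_comm (ENNReal.ofReal _), mul_assoc, lintegral_rpow_mul_norm_rpow μ hc hcγ hf,
    ← lintegral_const_mul' _ _ (ENNReal.rpow_ne_top_of_nonneg (by linarith) (measure_ne_top _ _))]
  refine lintegral_mono fun u => ?_
  rw [radialDensity, ENNReal.mul_rpow_of_nonneg _ _ hp0.le, mul_left_comm]
  gcongr
  exact hholder u

lemma lintegral_radialDensity_norm_rpow (hc : 0 < c) (hp : 1 < p)
    (hcγ : c * (p - 1) = Module.finrank ℝ E * (p - 1) - γ) {φ : ℝ → ℝ≥0∞} (hφ : Measurable φ) :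
    ∫⁻ u in Ioi (0 : ℝ), radialDensity μ c (fun x => φ ‖x‖) u ^ p =
      ENNReal.ofReal (c ^ (1 - p)) * μ.toSphere univ ^ (p - 1) *
        ∫⁻ x, φ ‖x‖ ^ p * ENNReal.ofReal (‖x‖ ^ γ) ∂μ := by
  have hp0 : 0 < p := by linarith
  have hp1 : 0 < p - 1 := by linarith
  rw [mul_comm (ENNReal.ofReal _), mul_assoc,
    lintegral_rpow_mul_norm_rpow μ hc hcγ (f := fun x => φ ‖x‖) (by fun_prop),
    ← lintegral_const_mul' _ _ (ENNReal.rpow_ne_top_of_nonneg hp1.le (measure_ne_top _ _))]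
  refine setLIntegral_congr_fun measurableSet_Ioi fun u (hu : 0 < u) => ?_
  have hsphere : μ.toSphere univ ^ p = μ.toSphere univ ^ (p - 1) * μ.toSphere univ := by
    conv_lhs => rw [← sub_add_cancel p 1, ENNReal.rpow_add_of_nonneg _ _ hp1.le zero_le_one,
      ENNReal.rpow_one]
  simp only [norm_rpow_smul_sphere _ hu.le, lintegral_const]
  rw [radialDensity_norm μ hu.le, ENNReal.mul_rpow_of_nonneg _ _ hp0.le,
    ENNReal.mul_rpow_of_nonneg _ _ hp0.le, hsphere]
  ring

lemma lintegral_comp_norm_rpow_mul (hc : 0 < c) (s : ℝ) {G : ℝ → ℝ≥0∞} (hG : Measurable G) :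
    ∫⁻ x, G (‖x‖ ^ c) * ENNReal.ofReal (‖x‖ ^ (-(Module.finrank ℝ E : ℝ) - c * s)) ∂μ =
      ENNReal.ofReal (1 / c) * μ.toSphere univ *
        ∫⁻ u in Ioi (0 : ℝ), G u * ENNReal.ofReal (u ^ (-1 - s)) := by
  rw [lintegral_eq_lintegral_radialDensity μ hc (by fun_prop), ← lintegral_const_mul' _ _
    (ENNReal.mul_ne_top ENNReal.ofReal_ne_top (measure_ne_top _ _))]
  refine setLIntegral_congr_fun measurableSet_Ioi fun u (hu : 0 < u) => ?_
  have hexp : u ^ (-1 - s) = u ^ (Module.finrank ℝ E / c - 1) *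
      u ^ (1 / c * (-(Module.finrank ℝ E : ℝ) - c * s)) := by
    rw [← Real.rpow_add hu]
    congr 1
    field
  rw [radialDensity_norm μ hu.le fun r =>
      G (r ^ c) * ENNReal.ofReal (r ^ (-(Module.finrank ℝ E : ℝ) - c * s)),
    ← Real.rpow_mul hu.le, ← Real.rpow_mul hu.le, one_div_mul_cancel hc.ne', Real.rpow_one, hexp,
    ENNReal.ofReal_mul (by positivity), ENNReal.ofReal_mul (by positivity)]
  ring

lemma radialDensity_mul_norm_rpow (hc : 0 < c) {u : ℝ} (hu : 0 < u) (h : ℝ → ℝ) :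
    radialDensity μ c (fun x => ENNReal.ofReal
      (c / (μ.toSphere univ).toReal * ‖x‖ ^ (c - Module.finrank ℝ E) * h (‖x‖ ^ c))) u =
      ENNReal.ofReal (h u) := by
  have hω : 0 < (μ.toSphere univ).toReal :=
    ENNReal.toReal_pos (Measure.measure_univ_ne_zero.2 μ.toSphere_ne_zero) (measure_ne_top _ _)
  have hexp : u ^ (Module.finrank ℝ E / c - 1) * u ^ (1 / c * (c - Module.finrank ℝ E)) = 1 := by
    rw [← Real.rpow_add hu, show Module.finrank ℝ E / c - 1 + 1 / c * (c - Module.finrank ℝ E) = 0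
      by field, Real.rpow_zero]
  rw [radialDensity_norm μ hu.le fun r => ENNReal.ofReal
      (c / (μ.toSphere univ).toReal * r ^ (c - Module.finrank ℝ E) * h (r ^ c)),
    ← ENNReal.ofReal_toReal (measure_ne_top μ.toSphere univ), mul_comm (ENNReal.ofReal (_ * h _)),
    ← ENNReal.ofReal_mul ENNReal.toReal_nonneg, ← ENNReal.ofReal_mul (by positivity),
    ENNReal.toReal_ofReal ENNReal.toReal_nonneg, ← Real.rpow_mul hu.le, ← Real.rpow_mul hu.le,
    one_div_mul_cancel hc.ne', Real.rpow_one]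
  congr 1
  field_simp at hexp ⊢
  linear_combination h u * hexp

end Polar

section OneVariable

variable {n : ℕ} {p q c α β γ : ℝ}

lemma toSphere_volume_univ (n : ℕ) :
    (volume : Measure (EuclideanSpace ℝ (Fin n))).toSphere univ = ENNReal.ofReal (sphereArea n) :=
  (ENNReal.ofReal_toReal (measure_ne_top _ _)).symm

/-- The measure `|x|^γ dx` on `ℝ^n`, the one-variable factor of `powerMeasure`. -/
def normPowMeasure (n : ℕ) (γ : ℝ) : Measure (EuclideanSpace ℝ (Fin n)) :=
  volume.withDensity fun x => ENNReal.ofReal (‖x‖ ^ γ)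

instance (n : ℕ) (γ : ℝ) : SigmaFinite (normPowMeasure n γ) :=
  SigmaFinite.withDensity_ofReal _

lemma lintegral_normPowMeasure (γ : ℝ) {f : EuclideanSpace ℝ (Fin n) → ℝ≥0∞}
    (hf : Measurable f) :
    ∫⁻ x, f x ∂normPowMeasure n γ = ∫⁻ x, f x * ENNReal.ofReal (‖x‖ ^ γ) := by
  rw [normPowMeasure, lintegral_withDensity_eq_lintegral_mul _ (by fun_prop) hf]
  simp only [Pi.mul_apply, mul_comm]

/-- The weight in front of the integral in the Hardy operator in one variable. -/
def hardyWeight (n : ℕ) (β : ℝ) (x : EuclideanSpace ℝ (Fin n)) : ℝ :=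
  1 / (volume (Metric.ball (0 : EuclideanSpace ℝ (Fin n)) ‖x‖)).toReal ^ (1 - β / (n : ℝ))

lemma hardyWeight_nonneg (n : ℕ) (β : ℝ) (x : EuclideanSpace ℝ (Fin n)) :
    0 ≤ hardyWeight n β x := by
  unfold hardyWeight
  positivity

@[fun_prop]
lemma measurable_hardyWeight (n : ℕ) (β : ℝ) : Measurable (hardyWeight n β) := by
  have hball : Measurable fun r : ℝ => volume (Metric.ball (0 : EuclideanSpace ℝ (Fin n)) r) :=
    Monotone.measurable fun r s hrs => measure_mono (Metric.ball_subset_ball hrs)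
  exact ((hball.comp measurable_norm).ennreal_toReal.pow_const _).const_div 1

/-- The kernel of the Hardy operator in one variable. -/
def hardyKernel (n : ℕ) (β : ℝ) (x y : EuclideanSpace ℝ (Fin n)) : ℝ≥0∞ :=
  (Metric.ball 0 ‖x‖).indicator (fun _ => ENNReal.ofReal (hardyWeight n β x)) y

lemma measurable_hardyKernel (n : ℕ) (β : ℝ) :
    Measurable (Function.uncurry (hardyKernel n β)) := by
  have hball : MeasurableSet {z : EuclideanSpace ℝ (Fin n) × EuclideanSpace ℝ (Fin n) |
      z.2 ∈ Metric.ball 0 ‖z.1‖} := by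
    simp only [mem_ball_zero_iff]
    exact measurableSet_lt (by fun_prop) (by fun_prop)
  exact Measurable.indicator (f := fun z : EuclideanSpace ℝ (Fin n) × EuclideanSpace ℝ (Fin n) =>
    ENNReal.ofReal (hardyWeight n β z.1)) (by fun_prop) hball

lemma measurable_lintegral_hardyKernel_mul (β : ℝ) {f : EuclideanSpace ℝ (Fin n) → ℝ≥0∞}
    (hf : Measurable f) : Measurable fun x => ∫⁻ y, hardyKernel n β x y * f y :=
  Measurable.lintegral_prod_right' (f := fun z : EuclideanSpace ℝ (Fin n) × _ =>
    hardyKernel n β z.1 z.2 * f z.2) ((measurable_hardyKernel n β).mul (by fun_prop))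

lemma lintegral_hardyKernel_mul (β : ℝ) (x : EuclideanSpace ℝ (Fin n))
    (f : EuclideanSpace ℝ (Fin n) → ℝ≥0∞) :
    ∫⁻ y, hardyKernel n β x y * f y =
      ENNReal.ofReal (hardyWeight n β x) * ∫⁻ y in Metric.ball 0 ‖x‖, f y := by
  rw [← lintegral_const_mul' _ _ ENNReal.ofReal_ne_top, ← lintegral_indicator measurableSet_ball]
  simp only [hardyKernel, ← indicator_mul_left]

lemma exists_pos_mul_sub_one_eq (hp : 1 < p) (hγ : γ < n * (p - 1)) :
    ∃ c, 0 < c ∧ c * (p - 1) = n * (p - 1) - γ :=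
  ⟨(n * (p - 1) - γ) / (p - 1), div_pos (by linarith) (by linarith),
    div_mul_cancel₀ _ (by linarith)⟩

variable [NeZero n]

lemma sphereArea_pos (n : ℕ) [NeZero n] : 0 < sphereArea n :=
  ENNReal.toReal_pos (Measure.measure_univ_ne_zero.2 (Measure.toSphere_ne_zero _))
    (measure_ne_top _ _)

lemma volume_ball_toReal {r : ℝ} (hr : 0 ≤ r) :
    (volume (Metric.ball (0 : EuclideanSpace ℝ (Fin n)) r)).toReal =
      sphereArea n / n * r ^ (n : ℝ) := by
  have hn : (n : ℝ) ≠ 0 := NeZero.ne _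
  rw [Measure.addHaar_ball _ _ hr, sphereArea, Measure.toSphere_apply_univ,
    finrank_euclideanSpace_fin, ENNReal.toReal_mul, ENNReal.toReal_mul, ENNReal.toReal_natCast,
    ENNReal.toReal_ofReal (by positivity), Real.rpow_natCast]
  field

lemma hardyWeight_eq (β : ℝ) (x : EuclideanSpace ℝ (Fin n)) :
    hardyWeight n β x = (sphereArea n / n * ‖x‖ ^ (n : ℝ)) ^ (-(1 - β / n)) := by
  rw [hardyWeight, volume_ball_toReal (norm_nonneg x), one_div, ← Real.rpow_neg]
  have := sphereArea_pos n
  positivity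

lemma hardyWeight_pos (β : ℝ) {x : EuclideanSpace ℝ (Fin n)} (hx : x ≠ 0) :
    0 < hardyWeight n β x := by
  have hω := sphereArea_pos n
  have hn := NeZero.pos n
  have := norm_pos_iff.2 hx
  rw [hardyWeight_eq]
  positivity

lemma hardyWeight_rpow_mul_norm_rpow (hp : 0 < p) (hq : 0 < q)
    (hcγ : c * (p - 1) = n * (p - 1) - γ) (hbal : β + (α + n) / q = (γ + n) / p)
    {x : EuclideanSpace ℝ (Fin n)} (hx : x ≠ 0) :
    hardyWeight n β x ^ q * ‖x‖ ^ α =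
      (sphereArea n / n) ^ (-(1 - β / n) * q) * ‖x‖ ^ (-(n : ℝ) - c * (q * ((p - 1) / p))) := by
  have hω := sphereArea_pos n
  have hn : (n : ℝ) ≠ 0 := NeZero.ne _
  have hx := norm_pos_iff.2 hx
  rw [hardyWeight_eq, ← Real.rpow_mul (by positivity), Real.mul_rpow (by positivity)
    (by positivity), ← Real.rpow_mul hx.le, mul_assoc, ← Real.rpow_add hx]
  congr 2
  field_simp at hbal ⊢
  linear_combination q * hcγ + hbal

/-- The factor of `sharpConst` that belongs to one variable. -/
def sharpFactor (n : ℕ) (β γ p q : ℝ) : ℝ :=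
  sphereArea n ^ (1 / q - 1 / p + β / (n : ℝ)) * (n : ℝ) ^ (1 / p - 1 / q - β / (n : ℝ)) *
    ((n : ℝ) * (p - 1) / ((n : ℝ) * (p - 1) - γ)) ^ (1 / p.conjExponent + 1 / q) *
    blissFactor p q

lemma sharpFactor_pos (β : ℝ) (hp : 1 < p) (hpq : p ≤ q) (hγ : γ < n * (p - 1)) :
    0 < sharpFactor n β γ p q := by
  have hω := sphereArea_pos n
  have hA := blissFactor_pos hp hpq
  have hn := NeZero.pos n
  have : 0 < n * (p - 1) - γ := by linarith
  have : 0 < p - 1 := by linarith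
  unfold sharpFactor
  positivity

lemma sharpFactor_rpow (hp : 1 < p) (hpq : p ≤ q) (hc : 0 < c)
    (hcγ : c * (p - 1) = n * (p - 1) - γ) :
    sharpFactor n β γ p q ^ q = (sphereArea n / n) ^ (-(1 - β / n) * q) *
      (1 / c * sphereArea n) * blissFactor p q ^ q *
      (c ^ (1 - p) * sphereArea n ^ (p - 1)) ^ (q / p) := by
  have : 0 < p := by linarith
  have hq0 : 0 < q := by linarith
  have hp1 : 0 < p - 1 := by linarith
  have hn : (0 : ℝ) < n := Nat.cast_pos.2 (NeZero.pos n)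
  rw [sharpFactor, ← hcγ, mul_div_mul_right _ _ hp1.ne']
  -- Both sides are products of powers, so their exponents can be compared after taking logarithms.
  obtain ⟨a, ha⟩ : ∃ a, sphereArea n = Real.exp a := ⟨_, (Real.exp_log (sphereArea_pos n)).symm⟩
  obtain ⟨b, hb⟩ : ∃ b, (n : ℝ) = Real.exp b := ⟨_, (Real.exp_log hn).symm⟩
  obtain ⟨d, hd⟩ : ∃ d, blissFactor p q = Real.exp d :=
    ⟨_, (Real.exp_log (blissFactor_pos hp hpq)).symm⟩
  obtain ⟨e, rfl⟩ : ∃ e, c = Real.exp e := ⟨_, (Real.exp_log hc).symm⟩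
  generalize β / (n : ℝ) = t
  rw [ha, hb, hd, Real.conjExponent, one_div (Real.exp e), ← Real.exp_neg]
  simp only [← Real.exp_sub, ← Real.exp_mul, ← Real.exp_add]
  congr 1
  field

lemma ofReal_sharpFactor_rpow (hp : 1 < p) (hpq : p ≤ q) (hγ : γ < n * (p - 1)) (hc : 0 < c)
    (hcγ : c * (p - 1) = n * (p - 1) - γ) :
    ENNReal.ofReal (sharpFactor n β γ p q) ^ q =
      ENNReal.ofReal ((sphereArea n / n) ^ (-(1 - β / n) * q)) *
        (ENNReal.ofReal (1 / c) * ENNReal.ofReal (sphereArea n)) *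
        ENNReal.ofReal (blissFactor p q) ^ q *
        (ENNReal.ofReal (c ^ (1 - p)) * ENNReal.ofReal (sphereArea n) ^ (p - 1)) ^ (q / p) := by
  have hω := sphereArea_pos n
  have hA := blissFactor_pos hp hpq
  have hqp : 0 ≤ q / p := div_nonneg (by linarith) (by linarith)
  rw [ENNReal.ofReal_rpow_of_pos (sharpFactor_pos β hp hpq hγ), sharpFactor_rpow hp hpq hc hcγ,
    ENNReal.ofReal_mul (by positivity), ENNReal.ofReal_mul (by positivity),
    ENNReal.ofReal_mul (by positivity), ENNReal.ofReal_mul (p := 1 / c) (by positivity),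
    ← ENNReal.ofReal_rpow_of_pos hA,
    ← ENNReal.ofReal_rpow_of_nonneg (p := q / p) (by positivity) hqp,
    ENNReal.ofReal_mul (p := c ^ (1 - p)) (by positivity), ENNReal.ofReal_rpow_of_pos hω]

lemma lintegral_hardyKernel_mul_rpow (hp : 0 < p) (hq : 0 < q) (hc : 0 < c)
    (hcγ : c * (p - 1) = n * (p - 1) - γ) (hbal : β + (α + n) / q = (γ + n) / p)
    {f : EuclideanSpace ℝ (Fin n) → ℝ≥0∞} (hf : Measurable f) :
    ∫⁻ x, (∫⁻ y, hardyKernel n β x y * f y) ^ q ∂normPowMeasure n α =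
      ENNReal.ofReal ((sphereArea n / n) ^ (-(1 - β / n) * q)) *
        (ENNReal.ofReal (1 / c) * ENNReal.ofReal (sphereArea n)) *
        ∫⁻ u in Ioi (0 : ℝ), (∫⁻ t in Ioo 0 u, radialDensity volume c f t) ^ q *
          ENNReal.ofReal (u ^ (-1 - q * ((p - 1) / p))) := by
  have hω := sphereArea_pos n
  have hpolar : ∀ᵐ x : EuclideanSpace ℝ (Fin n),
      (∫⁻ y, hardyKernel n β x y * f y) ^ q * ENNReal.ofReal (‖x‖ ^ α) =
        ENNReal.ofReal ((sphereArea n / n) ^ (-(1 - β / n) * q)) *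
          ((∫⁻ t in Ioo 0 (‖x‖ ^ c), radialDensity volume c f t) ^ q *
            ENNReal.ofReal (‖x‖ ^ (-(n : ℝ) - c * (q * ((p - 1) / p))))) := by
    filter_upwards [Measure.ae_ne volume (0 : EuclideanSpace ℝ (Fin n))] with x hx
    rw [lintegral_hardyKernel_mul,
      lintegral_ball_eq_lintegral_radialDensity _ hc (norm_nonneg x) hf,
      ENNReal.mul_rpow_of_nonneg _ _ hq.le, mul_right_comm,
      ENNReal.ofReal_rpow_of_pos (hardyWeight_pos β hx),
      ← ENNReal.ofReal_mul (Real.rpow_nonneg (hardyWeight_nonneg _ _ _) _),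
      hardyWeight_rpow_mul_norm_rpow hp hq hcγ hbal hx, ENNReal.ofReal_mul (by positivity)]
    ring
  rw [lintegral_normPowMeasure _ ((measurable_lintegral_hardyKernel_mul β hf).pow_const q),
    lintegral_congr_ae hpolar, lintegral_const_mul' _ _ ENNReal.ofReal_ne_top, mul_assoc]
  have hsubst := lintegral_comp_norm_rpow_mul (E := EuclideanSpace ℝ (Fin n)) volume hc
    (q * ((p - 1) / p))
    ((measurable_lintegral_Ioo (measurable_radialDensity volume c hf) 0).pow_const q)
  rw [finrank_euclideanSpace_fin, toSphere_volume_univ] at hsubst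
  rw [hsubst]

theorem kernelBound_hardyKernel (hp : 1 < p) (hpq : p ≤ q) (hγ : γ < n * (p - 1))
    (hbal : β + (α + n) / q = (γ + n) / p) :
    KernelBound p q (normPowMeasure n α) volume (hardyKernel n β)
      (fun y => ENNReal.ofReal (‖y‖ ^ γ)) (ENNReal.ofReal (sharpFactor n β γ p q) ^ q) :=
    fun f hf => by
  have hp0 : 0 < p := by linarith
  have hq0 : 0 < q := by linarith
  obtain ⟨c, hc, hcγ⟩ := exists_pos_mul_sub_one_eq hp hγ
  have hbliss := lintegral_primitive_rpow_le hp hpq (measurable_radialDensity volume c hf)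
  have hholder := lintegral_radialDensity_rpow_le volume hc hp
    (by rwa [finrank_euclideanSpace_fin]) hf
  rw [toSphere_volume_univ] at hholder
  rw [lintegral_hardyKernel_mul_rpow hp0 hq0 hc hcγ hbal hf,
    ofReal_sharpFactor_rpow hp hpq hγ hc hcγ]
  refine (mul_le_mul_right (hbliss.trans (mul_le_mul_right
    (ENNReal.rpow_le_rpow hholder (by positivity)) _)) _).trans_eq ?_
  rw [ENNReal.mul_rpow_of_nonneg _ (∫⁻ x, _ ∂_) (by positivity)]
  ring

lemma exists_radial_lintegral_hardyKernel_mul_rpow (hp : 1 < p) (hq : 0 < q) (hc : 0 < c)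
    (hcγ : c * (p - 1) = n * (p - 1) - γ) (hbal : β + (α + n) / q = (γ + n) / p) {h : ℝ → ℝ}
    (hh : Measurable h) (hh0 : ∀ t, 0 ≤ h t) :
    ∃ f : EuclideanSpace ℝ (Fin n) → ℝ, Measurable f ∧ (∀ x, 0 ≤ f x) ∧
      ∫⁻ u in Ioi (0 : ℝ), ENNReal.ofReal (h u) ^ p =
        ENNReal.ofReal (c ^ (1 - p)) * ENNReal.ofReal (sphereArea n) ^ (p - 1) *
          ∫⁻ x, ENNReal.ofReal (f x) ^ p ∂normPowMeasure n γ ∧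
      ∫⁻ x, (∫⁻ y, hardyKernel n β x y * ENNReal.ofReal (f y)) ^ q ∂normPowMeasure n α =
        ENNReal.ofReal ((sphereArea n / n) ^ (-(1 - β / n) * q)) *
          (ENNReal.ofReal (1 / c) * ENNReal.ofReal (sphereArea n)) *
          ∫⁻ u in Ioi (0 : ℝ), (∫⁻ t in Ioo 0 u, ENNReal.ofReal (h t)) ^ q *
            ENNReal.ofReal (u ^ (-1 - q * ((p - 1) / p))) := by
  have hω := sphereArea_pos n
  set φ : ℝ → ℝ := fun r => c / sphereArea n * r ^ (c - n) * h (r ^ c)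
  have hφ : Measurable φ := by fun_prop
  have hdensity : ∀ u ∈ Ioi (0 : ℝ), radialDensity volume c
      (fun x : EuclideanSpace ℝ (Fin n) => ENNReal.ofReal (φ ‖x‖)) u = ENNReal.ofReal (h u) := by
    intro u hu
    have := radialDensity_mul_norm_rpow (E := EuclideanSpace ℝ (Fin n)) volume hc hu h
    rwa [finrank_euclideanSpace_fin] at this
  have hnorm := lintegral_radialDensity_norm_rpow (E := EuclideanSpace ℝ (Fin n)) volume hc hp
    (by rwa [finrank_euclideanSpace_fin]) hφ.ennreal_ofReal
  rw [← lintegral_normPowMeasure _ (by fun_prop), toSphere_volume_univ,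
    setLIntegral_congr_fun measurableSet_Ioi fun u hu => congrArg (· ^ p) (hdensity u hu)] at hnorm
  have hprim : ∀ u, ∫⁻ t in Ioo 0 u, radialDensity volume c
      (fun x : EuclideanSpace ℝ (Fin n) => ENNReal.ofReal (φ ‖x‖)) t =
      ∫⁻ t in Ioo 0 u, ENNReal.ofReal (h t) := fun u =>
    setLIntegral_congr_fun measurableSet_Ioo fun t ht => hdensity t ht.1
  refine ⟨fun x => φ ‖x‖, by fun_prop, fun x => mul_nonneg (by positivity) (hh0 _), hnorm, ?_⟩
  rw [lintegral_hardyKernel_mul_rpow (by linarith) hq hc hcγ hbal (by fun_prop)]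
  simp only [hprim]

theorem exists_le_lintegral_hardyKernel_mul_rpow {C : ℝ} (hp : 1 < p) (hpq : p ≤ q)
    (hγ : γ < n * (p - 1)) (hbal : β + (α + n) / q = (γ + n) / p) (hC0 : 0 < C)
    (hC : C < sharpFactor n β γ p q) :
    ∃ f : EuclideanSpace ℝ (Fin n) → ℝ, Measurable f ∧ (∀ x, 0 ≤ f x) ∧
      ∫⁻ x, ENNReal.ofReal (f x) ^ p ∂normPowMeasure n γ ≠ 0 ∧
      ∫⁻ x, ENNReal.ofReal (f x) ^ p ∂normPowMeasure n γ ≠ ⊤ ∧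
      ENNReal.ofReal C ^ q * (∫⁻ x, ENNReal.ofReal (f x) ^ p ∂normPowMeasure n γ) ^ (q / p) ≤
        ∫⁻ x, (∫⁻ y, hardyKernel n β x y * ENNReal.ofReal (f y)) ^ q ∂normPowMeasure n α := by
  have hA := blissFactor_pos hp hpq
  have hS := sharpFactor_pos β hp hpq hγ
  have : 0 < p := by linarith
  have hq0 : 0 < q := by linarith
  obtain ⟨c, hc, hcγ⟩ := exists_pos_mul_sub_one_eq hp hγ
  set s := C / sharpFactor n β γ p q with hs
  have hs0 : 0 < s := by positivity
  obtain ⟨h, hhm, hh0, hne, hnt, hle⟩ := exists_le_lintegral_primitive_rpow hp hpq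
    (c := s * blissFactor p q) (by positivity) (mul_lt_of_lt_one_left hA ((div_lt_one hS).2 hC))
  obtain ⟨f, hf, hf0, hnorm, hop⟩ :=
    exists_radial_lintegral_hardyKernel_mul_rpow hp hq0 hc hcγ hbal hhm hh0
  rw [hnorm] at hne hnt hle
  refine ⟨f, hf, hf0, right_ne_zero_of_mul hne, fun htop => ?_, ?_⟩
  · rw [htop, ENNReal.mul_top] at hnt
    exacts [hnt rfl, left_ne_zero_of_mul hne]
  · refine hop ▸ le_trans (le_of_eq ?_) (mul_le_mul_right hle _)
    rw [show C = s * sharpFactor n β γ p q by rw [hs]; field, ENNReal.ofReal_mul hs0.le,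
      ENNReal.ofReal_mul hs0.le, ENNReal.mul_rpow_of_nonneg _ _ hq0.le,
      ENNReal.mul_rpow_of_nonneg _ _ hq0.le, ofReal_sharpFactor_rpow hp hpq hγ hc hcγ,
      ENNReal.mul_rpow_of_nonneg _ (∫⁻ x, _ ∂_) (by positivity)]
    ring

end OneVariable

section Product

variable {𝕜 : Type*} [RCLike 𝕜] {m : ℕ} {n : Fin m → ℕ} {p q : ℝ} {α β γ : Fin m → ℝ}

lemma prod_indicator_univ_pi {X : Fin m → Type*} (s : ∀ i, Set (X i)) (f : ∀ i, X i → ℝ≥0∞)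
    (x : ∀ i, X i) :
    ∏ i, (s i).indicator (f i) (x i) = (univ.pi s).indicator (fun x => ∏ i, f i (x i)) x := by
  by_cases hx : x ∈ univ.pi s
  · rw [indicator_of_mem hx]
    exact Finset.prod_congr rfl fun i _ => indicator_of_mem (hx i trivial) _
  · obtain ⟨i, hi⟩ : ∃ i, x i ∉ s i := by simpa using hx
    rw [indicator_of_notMem hx]
    exact Finset.prod_eq_zero (Finset.mem_univ i) (indicator_of_notMem hi _)

lemma powerMeasure_eq_pi (n : Fin m → ℕ) (γ : Fin m → ℝ) :
    powerMeasure n γ = Measure.pi fun i => normPowMeasure (n i) (γ i) := by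
  refine (Measure.pi_eq fun s hs => ?_).symm
  have hdensity : ∀ x : ProdSpace n, ENNReal.ofReal (∏ i, ‖x i‖ ^ γ i) =
      ∏ i, ENNReal.ofReal (‖x i‖ ^ γ i) := fun x =>
    ENNReal.ofReal_prod_of_nonneg fun i _ => by positivity
  simp only [powerMeasure, normPowMeasure, withDensity_apply _ (MeasurableSet.univ_pi hs),
    withDensity_apply _ (hs _), ← lintegral_indicator (MeasurableSet.univ_pi hs),
    ← lintegral_indicator (hs _), hdensity]
  rw [volume_pi, ← lintegral_pi_prod fun i => Measurable.indicator (by fun_prop) (hs i)]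
  exact lintegral_congr fun x => (prod_indicator_univ_pi s
    (fun i y => ENNReal.ofReal (‖y‖ ^ γ i)) x).symm

lemma measurable_ofReal_prod_norm_rpow (γ : Fin m → ℝ) :
    Measurable fun x : ProdSpace n => ENNReal.ofReal (∏ i, ‖x i‖ ^ γ i) :=
  (Finset.univ.measurable_fun_prod fun i _ => by fun_prop).ennreal_ofReal

lemma lintegral_powerMeasure (γ : Fin m → ℝ) {f : ProdSpace n → ℝ≥0∞} (hf : Measurable f) :
    ∫⁻ x, f x ∂powerMeasure n γ = ∫⁻ x, f x * ENNReal.ofReal (∏ i, ‖x i‖ ^ γ i) := by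
  rw [powerMeasure,
    lintegral_withDensity_eq_lintegral_mul _ (measurable_ofReal_prod_norm_rpow γ) hf]
  simp only [Pi.mul_apply, mul_comm]

lemma lintegral_powerMeasure_prod (γ : Fin m → ℝ)
    {f : ∀ i, EuclideanSpace ℝ (Fin (n i)) → ℝ≥0∞} (hf : ∀ i, Measurable (f i)) :
    ∫⁻ x, ∏ i, f i (x i) ∂powerMeasure n γ = ∏ i, ∫⁻ x, f i x ∂normPowMeasure (n i) (γ i) := by
  rw [powerMeasure_eq_pi, lintegral_pi_prod hf]

lemma powerMeasure_absolutelyContinuous (γ : Fin m → ℝ) : powerMeasure n γ ≪ volume :=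
  withDensity_absolutelyContinuous _ _

lemma weightedNorm_rpow (hp : 0 < p) (γ : Fin m → ℝ)
    (f : ProdSpace n → 𝕜) (r : ℝ) :
    weightedNorm p γ f ^ r = (∫⁻ x, ‖f x‖ₑ ^ p ∂powerMeasure n γ) ^ (r / p) := by
  rw [weightedNorm, eLpNorm_eq_lintegral_rpow_enorm_toReal (by simpa using hp)
    ENNReal.ofReal_ne_top, ENNReal.toReal_ofReal hp.le, ← ENNReal.rpow_mul, one_div_mul_eq_div]

lemma weightedNorm_rpow_self (hp : 0 < p) (γ : Fin m → ℝ)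
    (f : ProdSpace n → 𝕜) :
    weightedNorm p γ f ^ p = ∫⁻ x, ‖f x‖ₑ ^ p ∂powerMeasure n γ := by
  rw [weightedNorm_rpow hp, div_self hp.ne', ENNReal.rpow_one]

lemma ballBox_eq_pi (x : ProdSpace n) : ballBox x = univ.pi fun i => Metric.ball 0 ‖x i‖ := by
  ext y
  simp [ballBox]

lemma measurableSet_ballBox (x : ProdSpace n) : MeasurableSet (ballBox x) := by
  rw [ballBox_eq_pi]
  exact MeasurableSet.univ_pi fun _ => measurableSet_ball

/-- The kernel of `hardyOp`. -/
def prodHardyKernel (β : Fin m → ℝ) (x y : ProdSpace n) : ℝ≥0∞ :=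
  ∏ i, hardyKernel (n i) (β i) (x i) (y i)

lemma measurable_prodHardyKernel (β : Fin m → ℝ) :
    Measurable (Function.uncurry (prodHardyKernel (n := n) β)) :=
  Finset.univ.measurable_fun_prod fun i _ => (measurable_hardyKernel (n i) (β i)).comp
    (f := fun z : ProdSpace n × ProdSpace n => (z.1 i, z.2 i)) (by fun_prop)

lemma measurable_lintegral_prodHardyKernel_mul (β : Fin m → ℝ) {f : ProdSpace n → ℝ≥0∞}
    (hf : Measurable f) : Measurable fun x => ∫⁻ y, prodHardyKernel β x y * f y :=
  Measurable.lintegral_prod_right' (f := fun z : ProdSpace n × ProdSpace n =>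
    prodHardyKernel β z.1 z.2 * f z.2) ((measurable_prodHardyKernel β).mul (by fun_prop))

lemma prodHardyKernel_eq_indicator (β : Fin m → ℝ) (x y : ProdSpace n) :
    prodHardyKernel β x y = (ballBox x).indicator
      (fun _ => ENNReal.ofReal (∏ i, hardyWeight (n i) (β i) (x i))) y := by
  rw [ENNReal.ofReal_prod_of_nonneg fun i _ => hardyWeight_nonneg _ _ _, ballBox_eq_pi]
  exact prod_indicator_univ_pi _ (fun i _ => ENNReal.ofReal (hardyWeight (n i) (β i) (x i))) y

lemma lintegral_prodHardyKernel_mul (β : Fin m → ℝ) (x : ProdSpace n) (f : ProdSpace n → ℝ≥0∞) :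
    ∫⁻ y, prodHardyKernel β x y * f y =
      ENNReal.ofReal (∏ i, hardyWeight (n i) (β i) (x i)) * ∫⁻ y in ballBox x, f y := by
  rw [← lintegral_const_mul' _ _ ENNReal.ofReal_ne_top,
    ← lintegral_indicator (measurableSet_ballBox x)]
  simp only [prodHardyKernel_eq_indicator, ← indicator_mul_left]

lemma lintegral_prodHardyKernel_mul_prod (β : Fin m → ℝ)
    {f : ∀ i, EuclideanSpace ℝ (Fin (n i)) → ℝ≥0∞} (hf : ∀ i, Measurable (f i))
    (x : ProdSpace n) :
    ∫⁻ y, prodHardyKernel β x y * ∏ i, f i (y i) =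
      ∏ i, ∫⁻ y, hardyKernel (n i) (β i) (x i) y * f i y := by
  simp only [prodHardyKernel, ← Finset.prod_mul_distrib]
  exact lintegral_pi_prod fun i => (measurable_hardyKernel _ _).of_uncurry_left.mul (hf i)

lemma hardyOp_eq_smul (β : Fin m → ℝ) (f : ProdSpace n → 𝕜)
    (x : ProdSpace n) :
    hardyOp β f x = (∏ i, hardyWeight (n i) (β i) (x i)) • ∫ y in ballBox x, f y :=
  rfl

lemma hardyOp_eq_integral (β : Fin m → ℝ) (f : ProdSpace n → 𝕜)
    (x : ProdSpace n) : hardyOp β f x = ∫ y, (prodHardyKernel β x y).toReal • f y := by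
  have hw : 0 ≤ ∏ i, hardyWeight (n i) (β i) (x i) :=
    Finset.prod_nonneg fun _ _ => hardyWeight_nonneg _ _ _
  rw [hardyOp_eq_smul, ← integral_smul, ← integral_indicator (measurableSet_ballBox x)]
  congr 1 with y
  by_cases hy : y ∈ ballBox x <;> simp [prodHardyKernel_eq_indicator, hy, hw]

lemma hardyOp_congr_ae (β : Fin m → ℝ) {f g : ProdSpace n → 𝕜}
    (h : f =ᵐ[volume] g) : hardyOp β f = hardyOp β g := by
  ext x
  rw [hardyOp_eq_smul, hardyOp_eq_smul, integral_congr_ae (ae_restrict_of_ae h)]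

lemma stronglyMeasurable_hardyOp (β : Fin m → ℝ)
    {f : ProdSpace n → 𝕜} (hf : StronglyMeasurable f) : StronglyMeasurable (hardyOp β f) := by
  simp only [funext (hardyOp_eq_integral β f)]
  exact StronglyMeasurable.integral_prod_right' (f := fun z : ProdSpace n × ProdSpace n =>
    (prodHardyKernel β z.1 z.2).toReal • f z.2)
    ((measurable_prodHardyKernel β).ennreal_toReal.stronglyMeasurable.smul
      (hf.comp_measurable measurable_snd))

lemma enorm_hardyOp (β : Fin m → ℝ) (f : ProdSpace n → 𝕜)
    (x : ProdSpace n) :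
    ‖hardyOp β f x‖ₑ =
      ENNReal.ofReal (∏ i, hardyWeight (n i) (β i) (x i)) * ‖∫ y in ballBox x, f y‖ₑ := by
  rw [hardyOp_eq_smul, enorm_smul, Real.enorm_of_nonneg
    (Finset.prod_nonneg fun _ _ => hardyWeight_nonneg _ _ _)]

lemma enorm_hardyOp_le (β : Fin m → ℝ) (f : ProdSpace n → 𝕜)
    (x : ProdSpace n) : ‖hardyOp β f x‖ₑ ≤ ∫⁻ y, prodHardyKernel β x y * ‖f y‖ₑ := by
  rw [enorm_hardyOp, lintegral_prodHardyKernel_mul]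
  gcongr
  exact enorm_integral_le_lintegral_enorm _

lemma enorm_hardyOp_of_nonneg (β : Fin m → ℝ) {f : ProdSpace n → ℝ} (hf : ∀ x, 0 ≤ f x)
    {x : ProdSpace n} (hfi : IntegrableOn f (ballBox x)) :
    ‖hardyOp β f x‖ₑ = ∫⁻ y, prodHardyKernel β x y * ENNReal.ofReal (f y) := by
  rw [enorm_hardyOp, lintegral_prodHardyKernel_mul, Real.enorm_of_nonneg (integral_nonneg hf),
    ofReal_integral_eq_lintegral_ofReal hfi (Eventually.of_forall hf)]

lemma weightedNorm_prod_rpow_self (hp : 0 < p) (γ : Fin m → ℝ)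
    {f : ∀ i, EuclideanSpace ℝ (Fin (n i)) → ℝ} (hf : ∀ i, Measurable (f i))
    (hf0 : ∀ i x, 0 ≤ f i x) :
    weightedNorm p γ (fun x : ProdSpace n => ∏ i, f i (x i)) ^ p =
      ∏ i, ∫⁻ x, ENNReal.ofReal (f i x) ^ p ∂normPowMeasure (n i) (γ i) := by
  rw [weightedNorm_rpow_self hp, ← lintegral_powerMeasure_prod _ fun i => by fun_prop]
  refine lintegral_congr fun x => ?_
  rw [Real.enorm_of_nonneg (Finset.prod_nonneg fun i _ => hf0 i _),
    ENNReal.ofReal_prod_of_nonneg fun i _ => hf0 i _, ENNReal.prod_rpow_of_nonneg hp.le]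

lemma weightedNorm_hardyOp_prod_rpow_self (hq : 0 < q) (α β : Fin m → ℝ)
    {f : ∀ i, EuclideanSpace ℝ (Fin (n i)) → ℝ} (hf : ∀ i, Measurable (f i))
    (hf0 : ∀ i x, 0 ≤ f i x)
    (hfi : ∀ x : ProdSpace n, IntegrableOn (fun y : ProdSpace n => ∏ i, f i (y i)) (ballBox x)) :
    weightedNorm q α (hardyOp β fun x : ProdSpace n => ∏ i, f i (x i)) ^ q =
      ∏ i, ∫⁻ x, (∫⁻ y, hardyKernel (n i) (β i) x y * ENNReal.ofReal (f i y)) ^ q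
        ∂normPowMeasure (n i) (α i) := by
  rw [weightedNorm_rpow_self hq, ← lintegral_powerMeasure_prod _ fun i =>
    (measurable_lintegral_hardyKernel_mul _ (hf i).ennreal_ofReal).pow_const q]
  refine lintegral_congr fun x => ?_
  rw [enorm_hardyOp_of_nonneg β (fun y => Finset.prod_nonneg fun i _ => hf0 i _) (hfi x),
    ENNReal.prod_rpow_of_nonneg hq.le,
    ← lintegral_prodHardyKernel_mul_prod β (fun i => (hf i).ennreal_ofReal) x]
  simp only [ENNReal.ofReal_prod_of_nonneg fun i _ => hf0 i _]

lemma hardyNormNonneg_le_hardyNorm (𝕜 : Type*) [RCLike 𝕜] (p q : ℝ) (α β γ : Fin m → ℝ) :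
    hardyNormNonneg n β p γ q α ≤ hardyNorm 𝕜 n β p γ q α := by
  refine iSup₂_le fun f ⟨_, hf, hne⟩ => ?_
  have hnorm : weightedNorm p γ (fun x => (f x : 𝕜)) = weightedNorm p γ f :=
    eLpNorm_congr_norm_ae (.of_forall fun x => RCLike.norm_ofReal _)
  have hop : weightedNorm q α (hardyOp β fun x => (f x : 𝕜)) = weightedNorm q α (hardyOp β f) := by
    refine eLpNorm_congr_norm_ae (.of_forall fun x => ?_)
    rw [hardyOp_eq_smul, hardyOp_eq_smul, integral_ofReal, norm_smul, norm_smul,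
      RCLike.norm_ofReal, Real.norm_eq_abs (∫ y in ballBox x, f y)]
  rw [← hnorm, ← hop]
  exact le_iSup₂_of_le (f := fun (f : ProdSpace n → 𝕜)
    (_ : MemWeightedLp p γ f ∧ weightedNorm p γ f ≠ 0) =>
    weightedNorm q α (hardyOp β f) / weightedNorm p γ f) (fun x => (f x : 𝕜))
    ⟨MemLp.ofReal hf, hnorm ▸ hne⟩ le_rfl

lemma sharpConst_eq_prod (β γ : Fin m → ℝ) (p q : ℝ) :
    sharpConst n β γ p q = ∏ i, sharpFactor (n i) (β i) (γ i) p q :=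
  rfl

variable [∀ i, NeZero (n i)]

lemma ae_forall_ne_zero : ∀ᵐ x : ProdSpace n, ∀ i, x i ≠ 0 :=
  ae_all_iff.2 fun i => (Measure.quasiMeasurePreserving_eval
    (fun i => (volume : Measure (EuclideanSpace ℝ (Fin (n i))))) i).ae (Measure.ae_ne volume 0)

lemma volume_absolutelyContinuous_powerMeasure (γ : Fin m → ℝ) :
    volume ≪ powerMeasure n γ := by
  refine withDensity_absolutelyContinuous'
    (measurable_ofReal_prod_norm_rpow γ).aemeasurable ?_
  filter_upwards [ae_forall_ne_zero] with x hx
  exact (ENNReal.ofReal_pos.2 <| Finset.prod_pos fun i _ =>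
    Real.rpow_pos_of_pos (norm_pos_iff.2 (hx i)) _).ne'

theorem kernelBound_prodHardyKernel (hp : 1 < p) (hpq : p ≤ q) (hγ : ∀ i, γ i < n i * (p - 1))
    (hbal : ∀ i, β i + (α i + n i) / q = (γ i + n i) / p) :
    KernelBound p q (powerMeasure n α) volume (prodHardyKernel β)
      (fun y => ENNReal.ofReal (∏ i, ‖y i‖ ^ γ i)) (ENNReal.ofReal (sharpConst n β γ p q) ^ q) := by
  simp only [ENNReal.ofReal_prod_of_nonneg fun _ _ => Real.rpow_nonneg (norm_nonneg _) _]
  rw [sharpConst_eq_prod, ENNReal.ofReal_prod_of_nonneg fun i _ =>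
    (sharpFactor_pos (β i) hp hpq (hγ i)).le, ← ENNReal.prod_rpow_of_nonneg (by linarith),
    powerMeasure_eq_pi, volume_pi]
  exact KernelBound.pi (by linarith) hpq
    (fun i => kernelBound_hardyKernel hp hpq (hγ i) (hbal i))
    (fun i => measurable_hardyKernel _ _) fun i => by fun_prop

lemma lintegral_prodHardyKernel_mul_enorm_rpow_le (hp : 1 < p) (hpq : p ≤ q)
    (hγ : ∀ i, γ i < n i * (p - 1)) (hbal : ∀ i, β i + (α i + n i) / q = (γ i + n i) / p)
    {f : ProdSpace n → 𝕜} (hf : StronglyMeasurable f) :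
    ∫⁻ x, (∫⁻ y, prodHardyKernel β x y * ‖f y‖ₑ) ^ q ∂powerMeasure n α ≤
      (ENNReal.ofReal (sharpConst n β γ p q) * weightedNorm p γ f) ^ q := by
  rw [ENNReal.mul_rpow_of_nonneg _ _ (by linarith), weightedNorm_rpow (by linarith),
    lintegral_powerMeasure γ (hf.enorm.pow_const p)]
  exact kernelBound_prodHardyKernel hp hpq hγ hbal hf.enorm

lemma weightedNorm_hardyOp_le (hp : 1 < p) (hpq : p ≤ q)
    (hγ : ∀ i, γ i < n i * (p - 1)) (hbal : ∀ i, β i + (α i + n i) / q = (γ i + n i) / p)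
    {f : ProdSpace n → 𝕜} (hf : StronglyMeasurable f) :
    weightedNorm q α (hardyOp β f) ≤
      ENNReal.ofReal (sharpConst n β γ p q) * weightedNorm p γ f := by
  have hq0 : 0 < q := by linarith
  rw [← ENNReal.rpow_le_rpow_iff hq0, weightedNorm_rpow_self hq0]
  exact (lintegral_mono fun x => ENNReal.rpow_le_rpow (enorm_hardyOp_le β f x) hq0.le).trans
    (lintegral_prodHardyKernel_mul_enorm_rpow_le hp hpq hγ hbal hf)

lemma exists_forall_norm_lt_of_ae {P : ProdSpace n → Prop} (hP : ∀ᵐ x, P x) (x₀ : ProdSpace n) :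
    ∃ x : ProdSpace n, (∀ i, ‖x₀ i‖ < ‖x i‖) ∧ P x := by
  have hopen : IsOpen {x : ProdSpace n | ∀ i, ‖x₀ i‖ < ‖x i‖} := by
    simp only [Set.ofPred_forall]
    exact isOpen_iInter_of_finite fun i => isOpen_lt (by fun_prop) (by fun_prop)
  have hne : {x : ProdSpace n | ∀ i, ‖x₀ i‖ < ‖x i‖}.Nonempty := by
    choose x hx using fun i =>
      NormedSpace.exists_lt_norm ℝ (EuclideanSpace ℝ (Fin (n i))) ‖x₀ i‖
    exact ⟨x, hx⟩
  exact ((frequently_ae_mem_iff.2 (hopen.measure_pos volume hne).ne').and_eventually hP).exists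

-- If `f` were not integrable on one box, the positive kernel would have an infinite integral
-- against `‖f‖` on all larger ones, which form a set of positive measure.
lemma integrableOn_ballBox (hq : 0 < q) {f : ProdSpace n → 𝕜}
    (hf : StronglyMeasurable f)
    (hfin : ∫⁻ x, (∫⁻ y, prodHardyKernel β x y * ‖f y‖ₑ) ^ q ∂powerMeasure n α ≠ ⊤)
    (x₀ : ProdSpace n) : IntegrableOn f (ballBox x₀) := by
  have hae := (volume_absolutelyContinuous_powerMeasure α).ae_le
    (ae_lt_top ((measurable_lintegral_prodHardyKernel_mul β hf.enorm).pow_const q) hfin)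
  obtain ⟨x, hx, hxfin⟩ := exists_forall_norm_lt_of_ae hae x₀
  have hw : ENNReal.ofReal (∏ i, hardyWeight (n i) (β i) (x i)) ≠ 0 :=
    (ENNReal.ofReal_pos.2 <| Finset.prod_pos fun i _ =>
      hardyWeight_pos (β i) (norm_pos_iff.1 ((norm_nonneg _).trans_lt (hx i)))).ne'
  rw [ENNReal.rpow_lt_top_iff_of_pos hq, lintegral_prodHardyKernel_mul] at hxfin
  exact IntegrableOn.mono_set ⟨hf.aestronglyMeasurable, ENNReal.lt_top_of_mul_ne_top_right
    hxfin.ne hw⟩ fun y hy i => (hy i).trans (hx i)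

theorem memWeightedLp_hardyOp (hp : 1 < p) (hpq : p ≤ q)
    (hγ : ∀ i, γ i < n i * (p - 1)) (hbal : ∀ i, β i + (α i + n i) / q = (γ i + n i) / p)
    {f : ProdSpace n → 𝕜} (hf : MemWeightedLp p γ f) :
    (∀ x, IntegrableOn f (ballBox x)) ∧ MemWeightedLp q α (hardyOp β f) ∧
      weightedNorm q α (hardyOp β f) ≤
        ENNReal.ofReal (sharpConst n β γ p q) * weightedNorm p γ f := by
  have hq0 : 0 < q := by linarith
  wlog hfm : StronglyMeasurable f generalizing f
  · have hvol := hf.1.mono_ac (volume_absolutelyContinuous_powerMeasure γ)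
    have hae : f =ᵐ[powerMeasure n γ] hvol.mk f :=
      (powerMeasure_absolutelyContinuous γ).ae_le hvol.ae_eq_mk
    have hnorm : weightedNorm p γ f = weightedNorm p γ (hvol.mk f) := eLpNorm_congr_ae hae
    obtain ⟨hint, hmem, hle⟩ := this ((memLp_congr_ae hae).1 hf) hvol.stronglyMeasurable_mk
    rw [hardyOp_congr_ae β hvol.ae_eq_mk, hnorm]
    exact ⟨fun x => (integrable_congr (ae_restrict_of_ae hvol.ae_eq_mk)).2 (hint x), hmem, hle⟩
  have hfin : ENNReal.ofReal (sharpConst n β γ p q) * weightedNorm p γ f ≠ ⊤ :=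
    ENNReal.mul_ne_top ENNReal.ofReal_ne_top hf.2.ne
  have hle := weightedNorm_hardyOp_le hp hpq hγ hbal hfm
  exact ⟨integrableOn_ballBox hq0 hfm (ne_top_of_le_ne_top
      (ENNReal.rpow_ne_top_of_nonneg hq0.le hfin)
      (lintegral_prodHardyKernel_mul_enorm_rpow_le hp hpq hγ hbal hfm)),
    ⟨(stronglyMeasurable_hardyOp β hfm).aestronglyMeasurable, hle.trans_lt hfin.lt_top⟩, hle⟩

lemma ofReal_prod_le_hardyNormNonneg (hp : 1 < p) (hpq : p ≤ q)
    (hγ : ∀ i, γ i < n i * (p - 1)) (hbal : ∀ i, β i + (α i + n i) / q = (γ i + n i) / p)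
    {C : Fin m → ℝ} (hC0 : ∀ i, 0 < C i) (hC : ∀ i, C i < sharpFactor (n i) (β i) (γ i) p q) :
    ENNReal.ofReal (∏ i, C i) ≤ hardyNormNonneg n β p γ q α := by
  have hp0 : 0 < p := by linarith
  have hq0 : 0 < q := by linarith
  choose f hf hf0 hne hnt hle using fun i => exists_le_lintegral_hardyKernel_mul_rpow hp hpq
    (hγ i) (hbal i) (hC0 i) (hC i)
  set F : ProdSpace n → ℝ := fun x => ∏ i, f i (x i)
  have hFp : weightedNorm p γ F ^ p = _ := weightedNorm_prod_rpow_self hp0 γ hf hf0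
  have hF0 : weightedNorm p γ F ≠ 0 := fun h => by
    rw [h, ENNReal.zero_rpow_of_pos hp0] at hFp
    exact Finset.prod_ne_zero_iff.2 (fun i _ => hne i) hFp.symm
  have hFt : weightedNorm p γ F ≠ ⊤ := fun h => by
    rw [h, ENNReal.top_rpow_of_pos hp0] at hFp
    exact ENNReal.prod_ne_top (fun i _ => hnt i) hFp.symm
  have hF : MemWeightedLp p γ F :=
    ⟨(Finset.univ.measurable_fun_prod fun i _ => by fun_prop).aestronglyMeasurable, hFt.lt_top⟩
  have hFq : weightedNorm p γ F ^ q = (weightedNorm p γ F ^ p) ^ (q / p) := by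
    rw [← ENNReal.rpow_mul, mul_div_cancel₀ _ hp0.ne']
  refine le_iSup₂_of_le F ⟨fun x => Finset.prod_nonneg fun i _ => hf0 i _, hF, hF0⟩ ?_
  rw [ENNReal.le_div_iff_mul_le (Or.inl hF0) (Or.inl hFt), ← ENNReal.rpow_le_rpow_iff hq0,
    ENNReal.mul_rpow_of_nonneg _ _ hq0.le, hFq, hFp,
    weightedNorm_hardyOp_prod_rpow_self hq0 α β hf hf0 (memWeightedLp_hardyOp hp hpq hγ hbal hF).1,
    ENNReal.ofReal_prod_of_nonneg fun i _ => (hC0 i).le, ← ENNReal.prod_rpow_of_nonneg hq0.le,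
    ← ENNReal.prod_rpow_of_nonneg (by positivity), ← Finset.prod_mul_distrib]
  exact Finset.prod_le_prod' fun i _ => hle i

theorem ofReal_sharpConst_le_hardyNormNonneg (hp : 1 < p) (hpq : p ≤ q)
    (hγ : ∀ i, γ i < n i * (p - 1)) (hbal : ∀ i, β i + (α i + n i) / q = (γ i + n i) / p) :
    ENNReal.ofReal (sharpConst n β γ p q) ≤ hardyNormNonneg n β p γ q α := by
  have hS : ∀ i, 0 < sharpFactor (n i) (β i) (γ i) p q := fun i =>
    sharpFactor_pos (β i) hp hpq (hγ i)
  have hlim : Tendsto (fun t : ℝ => ENNReal.ofReal (∏ i, t * sharpFactor (n i) (β i) (γ i) p q))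
      (𝓝[<] 1) (𝓝 (ENNReal.ofReal (sharpConst n β γ p q))) := by
    have hcont : Continuous fun t : ℝ =>
        ENNReal.ofReal (∏ i, t * sharpFactor (n i) (β i) (γ i) p q) :=
      ENNReal.continuous_ofReal.comp (by fun_prop)
    simpa only [one_mul, ← sharpConst_eq_prod] using (hcont.tendsto 1).mono_left nhdsWithin_le_nhds
  refine le_of_tendsto hlim ?_
  filter_upwards [Ioo_mem_nhdsLT zero_lt_one] with t ht
  exact ofReal_prod_le_hardyNormNonneg hp hpq hγ hbal (fun i => mul_pos ht.1 (hS i))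
    fun i => mul_lt_of_lt_one_left (hS i) ht.2

end Product

theorem theorem2_general {𝕜 : Type*} [RCLike 𝕜] {m : ℕ} (n : Fin m → ℕ) [∀ i, NeZero (n i)]
    (p q : ℝ) (α β γ : Fin m → ℝ) (hp : 1 < p) (hpq : p ≤ q)
    (hγ : ∀ i, γ i < (n i : ℝ) * (p - 1))
    (hbal : ∀ i, β i + (α i + (n i : ℝ)) / q = (γ i + (n i : ℝ)) / p) :
    (∀ f : ProdSpace n → 𝕜, MemWeightedLp p γ f →
      (∀ x, IntegrableOn f (ballBox x)) ∧
      MemWeightedLp q α (hardyOp β f) ∧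
      weightedNorm q α (hardyOp β f) ≤
        ENNReal.ofReal (sharpConst n β γ p q) * weightedNorm p γ f) ∧
    hardyNorm 𝕜 n β p γ q α = ENNReal.ofReal (sharpConst n β γ p q) ∧
    hardyNormNonneg n β p γ q α = ENNReal.ofReal (sharpConst n β γ p q) := by
  have hupper : hardyNorm 𝕜 n β p γ q α ≤ ENNReal.ofReal (sharpConst n β γ p q) :=
    iSup₂_le fun f hf => ENNReal.div_le_of_le_mul
      (memWeightedLp_hardyOp hp hpq hγ hbal hf.1).2.2
  have hlower := ofReal_sharpConst_le_hardyNormNonneg hp hpq hγ hbal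
  have hmid := hardyNormNonneg_le_hardyNorm (n := n) 𝕜 p q α β γ
  exact ⟨fun f hf => memWeightedLp_hardyOp hp hpq hγ hbal hf,
    hupper.antisymm (hlower.trans hmid), (hmid.trans hupper).antisymm hlower⟩

end

theorem theorem2 {𝕜 : Type*} [RCLike 𝕜] {m : ℕ} (n : Fin m → ℕ) (p q : ℝ) (α β γ : Fin m → ℝ)
    (hp : 1 < p) (hpq : p ≤ q)
    (hβ₀ : ∀ i, 0 ≤ β i) (hβn : ∀ i, β i < (n i : ℝ))
    (hγ : ∀ i, γ i < (n i : ℝ) * (p - 1))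
    (hbal : ∀ i, β i + (α i + (n i : ℝ)) / q = (γ i + (n i : ℝ)) / p) :
    (∀ f : ProdSpace n → 𝕜, MemWeightedLp p γ f →
      (∀ x, IntegrableOn f (ballBox x)) ∧
      MemWeightedLp q α (hardyOp β f) ∧
      weightedNorm q α (hardyOp β f) ≤
        ENNReal.ofReal (sharpConst n β γ p q) * weightedNorm p γ f) ∧
    hardyNorm 𝕜 n β p γ q α = ENNReal.ofReal (sharpConst n β γ p q) ∧
    hardyNormNonneg n β p γ q α = ENNReal.ofReal (sharpConst n β γ p q) :=
  have (i : Fin m) : NeZero (n i) := .of_pos (Nat.cast_pos.1 ((hβ₀ i).trans_lt (hβn i)))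
  theorem2_general n p q α β γ hp hpq hγ hbal
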